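/- Let $0\le N_1\le N_2\le N_3$ be integers with $N_3\ge 1$, put $I_0=\{1,\dots,N_1\}$, $I_1=\{N_1+1,\dots,N_2\}$, $I_2=\{N_2+1,\dots,N_3\}$, and let $\gamma_i>0$ for $i\in I_1\cup I_2$. Set $$D=\min_{k,i\in I_2}\frac{\gamma_k}{\gamma_i},\qquad B=\frac1{1+\max_{i\in I_1}B_i},\qquad B_i=\max_{k\in I_2}\frac{\gamma_i}{\gamma_k}\quad(i\in I_1),$$ where a maximum over the empty set is $0$ (and $D$ is not needed if $I_2=\emptyset$). For $\underline\lambda=(\lambda_1,\dots,\lambda_{N_3})$ in $$U=(0,1)^{N_1}\times(0,B)^{N_2-N_1}\times(0,D)^{N_3-N_2}$$ consider the iterated function system $\mathcal G=\mathcal G_{\underline\lambda}=\{f_i\}_{i=1}^{N_3}$ on $\mathbb R$ given by $$f_i(x)=\lambda_ix\ (i\in I_0),\qquad f_i(x)=\lambda_ix+\gamma_i\lambda_i\ (i\in I_1),\qquad f_i(x)=-\lambda_ix+\gamma_i\lambda_i\ (i\in I_2).$$ For a finite word $\mathbf i=i_1\cdots i_n\in\{1,\dots,N_3\}^n$ write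 $\lambda_{\mathbf i}=\lambda_{i_1}\cdots\lambda_{i_n}$ and $\Pi(\mathbf i)=f_{i_1}\circ\cdots\circ f_{i_n}(0)$. The blocks of $\mathbf i$ are the successive maximal segments of $\mathbf i$ that either repeat a single symbol of $I_1\cup I_2$ or consist of symbols of $I_0$ only. Two words have the same block structure if they have the same number of blocks and, for every $l$, every symbol occurs equally often in their $l$-th blocks. The system $\mathcal G$ satisfies the exponential separation condition for common fixed point systems (ESC for CFS) if there exist $N\in\mathbb N$ and $b>1$ such that for every $n\ge N$ and all words $\mathbf i,\mathbf j$ of length $n$ with $\lambda_{\mathbf i}=\lambda_{\mathbf j}$, either $\mathbf i$ and $\mathbf j$ have the same block structure or $|\Pi(\mathbf i)-\Pi(\mathbf j)|>2^{-bn}$. Then there exists a set $\mathcal E\subset U$ with Hausdorff dimension $\dim_H\mathcal E\le N_3-1$ such that $\mathcal G_{\underline\lambda}$ satisfies the ESC for CFS for every $\underline\lambda\in U\setminus\mathcal E$. -/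

import Mathlib

/-!
The alphabet is `Fin N₃`, numbered from `0`.  The symbols `i < N₁` form the class `I₀` (maps fixing
`0`), those with `N₁ ≤ i < N₂` form `I₁` (orientation preserving maps with positive translation),
and those with `N₂ ≤ i` form `I₂` (orientation reversing maps with positive translation).
Finite words are lists of symbols; the words of length `n` are the lists of length `n`.
-/

noncomputable section

namespace CFS

variable {N₃ : ℕ}

/-- The class `I₁` of symbols. -/
abbrev I₁ (N₁ N₂ N₃ : ℕ) : Type := {i : Fin N₃ // N₁ ≤ (i : ℕ) ∧ (i : ℕ) < N₂}

/-- The class `I₂` of symbols. -/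
abbrev I₂ (N₂ N₃ : ℕ) : Type := {i : Fin N₃ // N₂ ≤ (i : ℕ)}

/-- The maps of the iterated function system `𝒢`:
`x ↦ λᵢ x` on `I₀`, `x ↦ λᵢ x + γᵢ λᵢ` on `I₁`, and `x ↦ -λᵢ x + γᵢ λᵢ` on `I₂`. -/
def ifsMap (N₁ N₂ : ℕ) (γ lam : Fin N₃ → ℝ) (i : Fin N₃) (x : ℝ) : ℝ :=
  if (i : ℕ) < N₁ then lam i * x
  else if (i : ℕ) < N₂ then lam i * x + γ i * lam i
  else -lam i * x + γ i * lam i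

/-- The composition `f_{i₁} ∘ ⋯ ∘ f_{iₙ}` along the word `i₁ ⋯ iₙ`. -/
def wordMap (N₁ N₂ : ℕ) (γ lam : Fin N₃ → ℝ) (w : List (Fin N₃)) (x : ℝ) : ℝ :=
  w.foldr (ifsMap N₁ N₂ γ lam) x

/-- The natural projection of a finite word: `Π(i₁ ⋯ iₙ) = f_{i₁} ∘ ⋯ ∘ f_{iₙ} (0)`. -/
def proj (N₁ N₂ : ℕ) (γ lam : Fin N₃ → ℝ) (w : List (Fin N₃)) : ℝ :=
  wordMap N₁ N₂ γ lam w 0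

/-- The product `λ_{i₁} ⋯ λ_{iₙ}` along the word `i₁ ⋯ iₙ`. -/
def wordRatio (lam : Fin N₃ → ℝ) (w : List (Fin N₃)) : ℝ := (w.map lam).prod

/-- The block representation of a finite word: its decomposition into successive maximal segments
that either repeat one symbol outside `I₀` or consist of symbols of `I₀` only. -/
def blocks (N₁ : ℕ) (w : List (Fin N₃)) : List (List (Fin N₃)) :=
  w.splitBy fun i j => decide (i = j ∨ ((i : ℕ) < N₁ ∧ (j : ℕ) < N₁))

/-- Two words have the same block structure if they have equally many blocks and every symbol
occurs equally often in the `l`-th block of the one and in the `l`-th block of the other,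
for every `l`. -/
def SameBlockStructure (N₁ : ℕ) (w v : List (Fin N₃)) : Prop :=
  List.Forall₂ (fun b c : List (Fin N₃) => ∀ k : Fin N₃, b.count k = c.count k)
    (blocks N₁ w) (blocks N₁ v)

/-- The exponential separation condition for common fixed point systems, for the system `𝒢` with
parameters `lam` and `γ`. -/
def ESC (N₁ N₂ : ℕ) (γ lam : Fin N₃ → ℝ) : Prop :=
  ∃ N : ℕ, ∃ b : ℝ, 1 < b ∧ ∀ n : ℕ, N ≤ n →
    ∀ w v : List (Fin N₃), w.length = n → v.length = n → wordRatio lam w = wordRatio lam v →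
      SameBlockStructure N₁ w v ∨
        (2 : ℝ) ^ (-(b * (n : ℝ))) < |proj N₁ N₂ γ lam w - proj N₁ N₂ γ lam v|

/-- `D = min_{k, i ∈ I₂} γₖ / γᵢ` (a minimum over a finite set; used only when `I₂` is
non-empty). -/
def boundD (N₂ : ℕ) (γ : Fin N₃ → ℝ) : ℝ :=
  ⨅ p : I₂ N₂ N₃ × I₂ N₂ N₃, γ p.1 / γ p.2

/-- `B = 1 / (1 + max_{i ∈ I₁} Bᵢ)` with `Bᵢ = max_{k ∈ I₂} γᵢ / γₖ` (maxima over finite sets of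
positive numbers, the maximum over the empty set being `0`). -/
def boundB (N₁ N₂ : ℕ) (γ : Fin N₃ → ℝ) : ℝ :=
  1 / (1 + ⨆ i : I₁ N₁ N₂ N₃, ⨆ k : I₂ N₂ N₃, γ i / γ k)

/-- The parameter domain `(0,1)^{N₁} × (0,B)^{N₂-N₁} × (0,D)^{N₃-N₂}` in `ℝ^{N₃}`. -/
def paramBox (N₁ N₂ : ℕ) (γ : Fin N₃ → ℝ) : Set (EuclideanSpace ℝ (Fin N₃)) :=
  {lam | ∀ i : Fin N₃, 0 < lam i ∧
    lam i < if (i : ℕ) < N₁ then 1 else if (i : ℕ) < N₂ then boundB N₁ N₂ γ else boundD N₂ γ}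

end CFS

end

/-! ### Covering estimates for points with superexponentially small values. -/

noncomputable section

namespace CFS

open MeasureTheory Filter Topology

/-! If the ESC fails at a parameter `x`, there are infinitely many lengths `n` with two words of
equal ratio, different block structure and superexponentially close projections. Apart from
countably many sets `λ_w = λ_v` with `w`, `v` not rearrangements of each other
(`dimH_wordRatio_eq_le`), equal ratio makes the words rearrangements. Cancelling what they share
(`sameBlockStructure_or_splitsAt`) then gives the difference of projections as a signed monomial
times a difference of two terms which, as polynomials in a suitable ratio `λ_k`, are told apart at
`λ_k = 0`: one vanishes there, the other does not.

The core is transversality at a fixed `x` (`exists_taylor_coeff_large`): the Taylor coefficients of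
such differences in direction `k` cannot be superexponentially small to every order. Dividing by
monomials costs only exponential factors and leaves `A - κ X^m Q`, where `A` and `Q` have uniformly
bounded coefficients, and the bounds defining the parameter box keep `A(0)`, `A(x_k)`, `Q(x_k)` away
from zero. Smallness of the value and of the first derivative bounds `m` and `κ`. A subsequential
limit would be a power series with bounded coefficients and nonzero constant term, all of whose
derivatives vanish at `x_k` in `(0,1)`, against the identity theorem.

So for some order `j` the coefficients up to `j` are superexponentially small along infinitely many
pairs while the next one is not (`exists_mem_smallCoeffSet_of_not_ESC`). Since that next one is, up
to the factor `j + 1`, the derivative of the `j`-th, the points in question lie, within a coarse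
cell, in a thin neighbourhood of a graph over the other coordinates. There are only exponentially
many pairs and the thickness decays at any exponential rate, so the dimension drops by one
(`dimH_small_value_le`); the union over `j` and the rate `b₁` is countable. -/

/-- A limsup set of finite families of sets whose `s`-volumes decay exponentially has Hausdorff
dimension at most `s`. -/
theorem dimH_le_of_limsup_cover {X : Type*} [EMetricSpace X] (T : Set X) (ι : ℕ → Type*)
    [∀ n, Fintype (ι n)] (S : ∀ n, ι n → Set X) (ρ : ℕ → ℝ) (s : NNReal)
    (hρ0 : ∀ n, 0 ≤ ρ n) (hanti : Antitone ρ) (hlim : Tendsto ρ atTop (𝓝 0))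
    (hd : ∀ n, 1 ≤ n → ∀ i, Metric.ediam (S n i) ≤ ENNReal.ofReal (ρ n))
    (hc : ∀ n, 1 ≤ n → (Fintype.card (ι n) : ℝ) * ρ n ^ (s : ℝ) ≤ (1 / 2) ^ n)
    (hT : ∀ m, ∀ x ∈ T, ∃ n, m ≤ n ∧ ∃ i, x ∈ S n i) : dimH T ≤ s := by
  borelize X
  refine dimH_le_of_hausdorffMeasure_ne_top (d := s) (ne_of_lt ?_)
  have key := Measure.hausdorffMeasure_le_liminf_tsum (s : ℝ) T (l := atTop)
    (ι := fun m : ℕ => Σ n : {n : ℕ // m ≤ n}, ι n)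
    (fun m => ENNReal.ofReal (ρ m)) (by simpa using ENNReal.tendsto_ofReal hlim)
    (fun m p => S p.1 p.2)
    (by
      filter_upwards [eventually_ge_atTop 1] with m hm p
      exact (hd _ (hm.trans p.1.2) _).trans (ENNReal.ofReal_le_ofReal (hanti p.1.2)))
    (Eventually.of_forall fun m x hx => by
      obtain ⟨n, hn, i, hi⟩ := hT m x hx
      exact Set.mem_iUnion.2 ⟨⟨⟨n, hn⟩, i⟩, hi⟩)
  refine key.trans_lt ?_
  have hb : ∀ m : ℕ, 1 ≤ m →
      ∑' p : (Σ n : {n : ℕ // m ≤ n}, ι n), Metric.ediam (S p.1 p.2) ^ (s : ℝ) ≤ 2 := by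
    intro m hm
    rw [ENNReal.tsum_sigma']
    have h1 : ∀ n : {n : ℕ // m ≤ n},
        ∑' i : ι n, Metric.ediam (S n i) ^ (s : ℝ) ≤ (2⁻¹ : ENNReal) ^ (n : ℕ) := by
      intro n
      have hn := hm.trans n.2
      rw [tsum_fintype]
      calc ∑ i : ι n, Metric.ediam (S n i) ^ (s : ℝ)
          ≤ ∑ _i : ι n, ENNReal.ofReal (ρ n) ^ (s : ℝ) :=
            Finset.sum_le_sum fun i _ => ENNReal.rpow_le_rpow (hd _ hn i) s.coe_nonneg
        _ = ENNReal.ofReal ((Fintype.card (ι n) : ℝ) * ρ n ^ (s : ℝ)) := by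
            rw [ENNReal.ofReal_mul (by positivity),
              ENNReal.ofReal_rpow_of_nonneg (hρ0 _) s.coe_nonneg]
            simp
        _ ≤ ENNReal.ofReal ((1 / 2) ^ (n : ℕ)) := ENNReal.ofReal_le_ofReal (hc _ hn)
        _ = _ := by
            rw [ENNReal.ofReal_pow (by norm_num)]
            congr 1
            rw [one_div, ENNReal.ofReal_inv_of_pos (by norm_num)]
            simp
    calc _ ≤ ∑' n : {n : ℕ // m ≤ n}, (2⁻¹ : ENNReal) ^ (n : ℕ) := ENNReal.tsum_le_tsum h1
      _ ≤ ∑' n : ℕ, (2⁻¹ : ENNReal) ^ n :=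
          ENNReal.tsum_comp_le_tsum_of_injective Subtype.val_injective _
      _ = 2 := by rw [ENNReal.tsum_geometric, ENNReal.one_sub_inv_two, inv_inv]
  calc _ ≤ liminf (fun _ : ℕ => (2 : ENNReal)) atTop :=
        liminf_le_liminf (by filter_upwards [eventually_ge_atTop 1] with m hm using hb m hm)
    _ < ⊤ := by simp

/-- The open unit cube. -/
def unitCube (d : ℕ) : Set (Fin d → ℝ) := {x | ∀ i, x i ∈ Set.Ioo (0 : ℝ) 1}

theorem floor_mul_lt {x : ℝ} (hx : x ∈ Set.Ioo (0 : ℝ) 1) (Q : ℕ) (hQ : 0 < Q) :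
    ⌊x * Q⌋₊ < Q := by
  have hQ' : (0 : ℝ) < Q := by exact_mod_cast hQ
  rw [Nat.floor_lt (by have := hx.1; positivity)]
  nlinarith [hx.2]

theorem abs_sub_le_of_floor_eq {x y : ℝ} (hx : 0 < x) (hy : 0 < y) (Q : ℕ) (hQ : 0 < Q)
    (h : ⌊x * Q⌋₊ = ⌊y * Q⌋₊) : |x - y| ≤ (Q : ℝ)⁻¹ := by
  have hQ' : (0 : ℝ) < Q := by exact_mod_cast hQ
  have h1 := Nat.floor_le (show 0 ≤ x * Q by positivity)
  have h2 := Nat.lt_floor_add_one (x * Q)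
  have h3 := Nat.floor_le (show 0 ≤ y * Q by positivity)
  have h4 := Nat.lt_floor_add_one (y * Q)
  rw [h] at h1 h2
  rw [← one_div, le_div_iff₀ hQ', ← abs_of_pos hQ', ← abs_mul, abs_le]
  constructor <;> nlinarith

/-- If `f` is nearly zero at two points which are close to each other and its derivative in the
direction `k` is not too small, then the `k`-th coordinates of the points are controlled by the
other coordinates. -/
theorem abs_coord_sub_le {d : ℕ} (k : Fin d) (f f' : (Fin d → ℝ) → ℝ) {C ε δ η : ℝ}
    (hL : ∀ x ∈ unitCube d, ∀ y ∈ unitCube d, |f x - f y| ≤ C * ‖x - y‖)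
    (hT : ∀ x ∈ unitCube d, ∀ y ∈ unitCube d, (∀ i, i ≠ k → x i = y i) →
      |f y - f x - f' x * (y k - x k)| ≤ C * (y k - x k) ^ 2)
    (hC : 0 ≤ C) (hδ : 0 < δ) (hη : 0 ≤ η)
    {x y : Fin d → ℝ} (hx : x ∈ unitCube d) (hy : y ∈ unitCube d)
    (hfx : |f x| ≤ ε) (hfy : |f y| ≤ ε) (hfx' : δ ≤ |f' x|)
    (hclose : C * |y k - x k| ≤ δ / 2) (hxy : ∀ i, i ≠ k → |x i - y i| ≤ η) :
    |x k - y k| ≤ 2 / δ * (2 * ε + C * η) := by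
  -- From `x` to `z` only the `k`-th coordinate moves, so the derivative governs; from `z` to `y`
  -- that coordinate is fixed and the Lipschitz bound suffices.
  set z := Function.update x k (y k) with hz
  have hzk : z k = y k := by simp [hz]
  have hzi : ∀ i, i ≠ k → z i = x i := fun i hi => by simp [hz, hi]
  have hzU : z ∈ unitCube d := fun i => by
    by_cases hi : i = k
    · subst hi; rw [hzk]; exact hy i
    · rw [hzi i hi]; exact hx i
  have hzy : ‖z - y‖ ≤ η := by
    rw [pi_norm_le_iff_of_nonneg hη]
    intro i
    by_cases hi : i = k
    · subst hi; simpa [hzk] using hη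
    · simpa [hzi i hi] using hxy i hi
  have h1 := hL z hzU y hy
  have h2 := hT x hx z hzU fun i hi => (hzi i hi).symm
  rw [hzk] at h2
  have h3 : C * ‖z - y‖ ≤ C * η := mul_le_mul_of_nonneg_left hzy hC
  have h4 : |f' x| * |y k - x k| ≤ 2 * ε + C * η + C * |y k - x k| ^ 2 := by
    rw [← abs_mul, sq_abs]
    have e : f' x * (y k - x k) =
        f y - f x + (f z - f y) - (f z - f x - f' x * (y k - x k)) := by ring
    rw [e]
    have a1 := abs_sub (f y - f x + (f z - f y)) (f z - f x - f' x * (y k - x k))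
    have a2 := abs_add_le (f y - f x) (f z - f y)
    have a3 := abs_sub (f y) (f x)
    linarith
  have h5 : δ * |y k - x k| ≤ |f' x| * |y k - x k| :=
    mul_le_mul_of_nonneg_right hfx' (abs_nonneg _)
  have h6 : C * |y k - x k| ^ 2 ≤ δ / 2 * |y k - x k| := by
    rw [sq, ← mul_assoc]; exact mul_le_mul_of_nonneg_right hclose (abs_nonneg _)
  rw [abs_sub_comm, div_mul_eq_mul_div, le_div_iff₀ hδ]
  linarith

/-- The set of points at which infinitely many functions of an exponentially growing family are
superexponentially small while a fixed partial derivative of them is not has Hausdorff dimension at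
most the dimension of the space minus one. -/
theorem dimH_small_value_le {α : Type*} {d : ℕ} (k : α → Fin (d + 1)) (G : ℕ → Finset α)
    (f f' : α → (Fin (d + 1) → ℝ) → ℝ) (μ c b₁ : ℕ) (hc1 : 1 ≤ c)
    (hcard : ∀ n, 1 ≤ n → (G n).card ≤ 2 ^ (μ * n))
    (hL : ∀ n, 1 ≤ n → ∀ g ∈ G n, ∀ x ∈ unitCube (d + 1), ∀ y ∈ unitCube (d + 1),
      |f g x - f g y| ≤ 2 ^ (c * n) * ‖x - y‖)
    (hT : ∀ n, 1 ≤ n → ∀ g ∈ G n, ∀ x ∈ unitCube (d + 1), ∀ y ∈ unitCube (d + 1),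
      (∀ i, i ≠ k g → x i = y i) →
      |f g y - f g x - f' g x * (y (k g) - x (k g))| ≤ 2 ^ (c * n) * (y (k g) - x (k g)) ^ 2) :
    dimH {x | x ∈ unitCube (d + 1) ∧ ∀ b m : ℕ, ∃ n, m ≤ n ∧ ∃ g ∈ G n,
      |f g x| ≤ (1 / 2) ^ (b * n) ∧ (1 / 2) ^ (b₁ * n) ≤ |f' g x|} ≤ d := by
  refine ENNReal.le_of_forall_pos_le_add fun η hη _ => ?_
  have hη' : (0 : ℝ) < η := hη
  -- In coarse cells of side `2^(-qn)` the quadratic error is at most half the linear term; the 3 in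
  -- `e` pays for the numerical constants in the resulting bound.
  set q := b₁ + c + 1 with hq
  set e := b₁ + c + 3 with he
  -- The gain `b * η` must outweigh the number of functions, the coarse cells and the loss `e` of
  -- precision, with one more unit for geometric decay.
  obtain ⟨b, hb⟩ := exists_nat_ge
    ((μ + q * (d + 1) + e * (d + η) + 1 : ℝ) / η + e + 1)
  have hbe : e + 1 ≤ b := by
    have : (0 : ℝ) ≤ (μ + q * (d + 1) + e * (d + η) + 1 : ℝ) / η := by positivity
    exact_mod_cast (show ((e + 1 : ℕ) : ℝ) ≤ b by push_cast; linarith)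
  have hbη : (μ + q * (d + 1) + e * (d + η) + 1 : ℝ) ≤ b * η := by
    rw [← div_le_iff₀ hη']
    have : (0 : ℝ) ≤ (e : ℝ) := by positivity
    linarith
  obtain ⟨p, rfl⟩ := Nat.exists_eq_add_of_le (show e ≤ b by omega)
  have hp : 1 ≤ p := by omega
  have hcast : ((d : ENNReal) + (η : ENNReal)) = ((d + η : NNReal) : ENNReal) := by push_cast; rfl
  rw [hcast]
  -- Cells are coarse in all `d + 1` coordinates but fine only in the `d` coordinates other than `k
  -- g`, which is where a dimension is saved.
  refine dimH_le_of_limsup_cover _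
    (fun n => (G n) × (Fin (d + 1) → Fin (2 ^ (q * n))) × (Fin d → Fin (2 ^ ((e + p) * n))))
    (fun n i => {x | x ∈ unitCube (d + 1) ∧ |f i.1 x| ≤ (1 / 2) ^ ((e + p) * n) ∧
      (1 / 2) ^ (b₁ * n) ≤ |f' i.1 x| ∧ (∀ j, ⌊x j * (2 ^ (q * n) : ℕ)⌋₊ = i.2.1 j) ∧
      ∀ j, ⌊x ((k i.1).succAbove j) * (2 ^ ((e + p) * n) : ℕ)⌋₊ = i.2.2 j})
    (fun n => (1 / 2) ^ (p * n)) (d + η) (fun n => by positivity) ?_ ?_ ?_ ?_ ?_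
  · intro a b hab
    exact pow_le_pow_of_le_one (by norm_num) (by norm_num) (Nat.mul_le_mul_left p hab)
  · simp_rw [pow_mul]
    exact tendsto_pow_atTop_nhds_zero_of_lt_one (by positivity)
      (pow_lt_one₀ (by norm_num) (by norm_num) (by omega))
  · rintro n hn ⟨⟨g, hg⟩, u, v⟩
    refine Metric.ediam_le ?_
    rintro x ⟨hxU, hx1, hx2, hx3, hx4⟩ y ⟨hyU, hy1, hy2, hy3, hy4⟩
    dsimp only at hx1 hx2 hx3 hx4 hy1 hy2 hy3 hy4
    rw [edist_dist]
    refine ENNReal.ofReal_le_ofReal ?_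
    rw [dist_pi_le_iff (by positivity)]
    have hb_le : ((1 : ℝ) / 2) ^ ((e + p) * n) ≤ (1 / 2) ^ (p * n) :=
      pow_le_pow_of_le_one (by norm_num) (by norm_num) (Nat.mul_le_mul_right n (by omega))
    have hQ : ∀ j, |x j - y j| ≤ (1 / 2) ^ (q * n) := fun j => by
      have := abs_sub_le_of_floor_eq (hxU j).1 (hyU j).1 (2 ^ (q * n)) (by positivity)
        ((hx3 j).trans (hy3 j).symm)
      simpa using this
    have hP : ∀ i, i ≠ k g → |x i - y i| ≤ (1 / 2) ^ ((e + p) * n) := fun i hi => by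
      obtain ⟨j, rfl⟩ := Fin.exists_succAbove_eq hi
      have := abs_sub_le_of_floor_eq (hxU _).1 (hyU _).1 (2 ^ ((e + p) * n)) (by positivity)
        ((hx4 j).trans (hy4 j).symm)
      simpa using this
    have h2 : (2 : ℝ) ≤ 2 ^ (c * n) := by
      have := pow_le_pow_right₀ (show (1 : ℝ) ≤ 2 by norm_num) (show 1 ≤ c * n from Nat.mul_pos hc1 hn)
      simpa using this
    have hk : |x (k g) - y (k g)| ≤ 2 / (1 / 2) ^ (b₁ * n) *
        (2 * (1 / 2) ^ ((e + p) * n) + 2 ^ (c * n) * (1 / 2) ^ ((e + p) * n)) := by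
      refine abs_coord_sub_le (k g) (f g) (f' g) (hL n hn g hg) (hT n hn g hg) (by positivity)
        (by positivity) (by positivity) hxU hyU hx1 hy1 hx2 ?_ hP
      have h3 := hQ (k g)
      rw [abs_sub_comm] at h3
      calc (2 : ℝ) ^ (c * n) * |y (k g) - x (k g)| ≤ 2 ^ (c * n) * (1 / 2) ^ (q * n) := by gcongr
        _ = (1 / 2) ^ (b₁ * n) * (1 / 2) ^ n := by
            rw [hq, show (b₁ + c + 1) * n = b₁ * n + c * n + n by ring, pow_add, pow_add]
            have : (2 : ℝ) ^ (c * n) * (1 / 2) ^ (c * n) = 1 := by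
              rw [← mul_pow]; norm_num
            linear_combination ((1 : ℝ) / 2) ^ (b₁ * n) * (1 / 2) ^ n * this
        _ ≤ (1 / 2) ^ (b₁ * n) * (1 / 2) ^ 1 := by
            gcongr ?_ * ?_
            exact pow_le_pow_of_le_one (by norm_num) (by norm_num) hn
        _ = _ := by ring
    have hk' : 2 / (1 / 2) ^ (b₁ * n) *
        (2 * (1 / 2) ^ ((e + p) * n) + 2 ^ (c * n) * (1 / 2) ^ ((e + p) * n)) ≤
        ((1 : ℝ) / 2) ^ (p * n) := by
      have e1 : 2 / (1 / 2) ^ (b₁ * n) = 2 * (2 : ℝ) ^ (b₁ * n) := by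
        rw [one_div, inv_pow, div_inv_eq_mul]
      have e2 : ((1 : ℝ) / 2) ^ ((e + p) * n) = (1 / 2) ^ (e * n) * (1 / 2) ^ (p * n) := by
        rw [← pow_add]; ring_nf
      have e3 : (2 : ℝ) ^ (b₁ * n) * 2 ^ (c * n) * 2 ^ (3 * n) * (1 / 2) ^ (e * n) = 1 := by
        rw [← pow_add, ← pow_add, ← add_mul, ← add_mul, ← mul_pow]; norm_num
      have e4 : (8 : ℝ) ≤ 2 ^ (3 * n) := by
        have := pow_le_pow_right₀ (show (1 : ℝ) ≤ 2 by norm_num) (show 3 ≤ 3 * n by omega)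
        norm_num at this; exact this
      rw [e1, e2]
      calc _ = (2 * (2 : ℝ) ^ (b₁ * n) * (2 + 2 ^ (c * n)) * (1 / 2) ^ (e * n)) *
            (1 / 2) ^ (p * n) := by ring
        _ ≤ ((2 : ℝ) ^ (b₁ * n) * 2 ^ (c * n) * 2 ^ (3 * n) * (1 / 2) ^ (e * n)) *
            (1 / 2) ^ (p * n) := by
            gcongr ?_ * _ * _
            have : 2 * (2 + (2 : ℝ) ^ (c * n)) ≤ 2 ^ (c * n) * 2 ^ (3 * n) := by nlinarith
            have h0 : (0 : ℝ) < 2 ^ (b₁ * n) := by positivity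
            nlinarith
        _ = _ := by rw [e3, one_mul]
    intro i
    rw [Real.dist_eq]
    by_cases hi : i = k g
    · subst hi; exact hk.trans hk'
    · exact (hP i hi).trans hb_le
  · intro n hn
    have hcardι : (Fintype.card ((G n) × (Fin (d + 1) → Fin (2 ^ (q * n))) ×
        (Fin d → Fin (2 ^ ((e + p) * n)))) : ℝ) ≤
        2 ^ (μ * n) * ((2 ^ (q * n)) ^ (d + 1) * (2 ^ ((e + p) * n)) ^ d) := by
      have : ((G n).card : ℝ) ≤ 2 ^ (μ * n) := by exact_mod_cast hcard n hn
      simp only [Fintype.card_prod, Fintype.card_coe, Fintype.card_fun, Fintype.card_fin]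
      push_cast
      gcongr
    refine (mul_le_mul_of_nonneg_right hcardι (by positivity)).trans ?_
    have e1 : ∀ m : ℕ, (2 : ℝ) ^ m = 2 ^ (m : ℝ) := fun m => (Real.rpow_natCast 2 m).symm
    have e2 : ∀ m : ℕ, ((1 : ℝ) / 2) ^ m = 2 ^ (-(m : ℝ)) := fun m => by
      rw [Real.rpow_neg (by norm_num), Real.rpow_natCast]; simp
    rw [← pow_mul, ← pow_mul, ← pow_add, ← pow_add, e1, e2, e2, ← Real.rpow_mul (by norm_num),
      ← Real.rpow_add (by norm_num)]
    refine Real.rpow_le_rpow_of_exponent_le (by norm_num) ?_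
    push_cast at hbη ⊢
    have hn' : (1 : ℝ) ≤ n := by exact_mod_cast hn
    have := mul_le_mul_of_nonneg_right hbη (show (0 : ℝ) ≤ n by positivity)
    nlinarith
  · rintro m x ⟨hxU, hx⟩
    obtain ⟨n, hn, g, hg, h1, h2⟩ := hx (e + p) m
    refine ⟨n, hn, ⟨⟨g, hg⟩, fun j => ⟨⌊x j * (2 ^ (q * n) : ℕ)⌋₊, ?_⟩,
      fun j => ⟨⌊x ((k g).succAbove j) * (2 ^ ((e + p) * n) : ℕ)⌋₊, ?_⟩⟩,
      hxU, h1, h2, fun j => rfl, fun j => rfl⟩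
    · exact floor_mul_lt (hxU _) _ (by positivity)
    · exact floor_mul_lt (hxU _) _ (by positivity)

end CFS
end

/-! ### Word values over a ring and their Taylor expansions in one ratio. -/

noncomputable section

namespace CFS

open Polynomial

/-- The maps of the iterated function system over a commutative ring. -/
def letterMap {R : Type*} [CommRing R] {N : ℕ} (N₁ N₂ : ℕ) (g ℓ : Fin N → R) (i : Fin N) (x : R) :
    R :=
  if (i : ℕ) < N₁ then ℓ i * x
  else if (i : ℕ) < N₂ then ℓ i * (x + g i)
  else ℓ i * (-x + g i)

/-- The compositions of the maps `letterMap` along words. -/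
def wordEval {R : Type*} [CommRing R] {N : ℕ} (N₁ N₂ : ℕ) (g ℓ : Fin N → R) (w : List (Fin N))
    (x : R) : R :=
  w.foldr (letterMap N₁ N₂ g ℓ) x

section wordEval

variable {R S : Type*} [CommRing R] [CommRing S] {N N₁ N₂ : ℕ} (g ℓ : Fin N → R)

@[simp] theorem wordEval_nil (x : R) : wordEval N₁ N₂ g ℓ [] x = x := rfl

@[simp] theorem wordEval_cons (i : Fin N) (w : List (Fin N)) (x : R) :
    wordEval N₁ N₂ g ℓ (i :: w) x = letterMap N₁ N₂ g ℓ i (wordEval N₁ N₂ g ℓ w x) := rfl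

theorem wordEval_append (w v : List (Fin N)) (x : R) :
    wordEval N₁ N₂ g ℓ (w ++ v) x = wordEval N₁ N₂ g ℓ w (wordEval N₁ N₂ g ℓ v x) := by
  simp [wordEval, List.foldr_append]

/-- Word values are integer polynomials in the data, hence natural in the ring. This links real
values, polynomials in one ratio and Taylor expansions. -/
theorem map_wordEval (φ : R →+* S) (w : List (Fin N)) (x : R) :
    φ (wordEval N₁ N₂ g ℓ w x) =
      wordEval N₁ N₂ (fun i => φ (g i)) (fun i => φ (ℓ i)) w (φ x) := by
  induction w with
  | nil => rfl
  | cons i w ih =>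
    rw [wordEval_cons, wordEval_cons, ← ih]
    unfold letterMap
    split_ifs <;> simp

theorem wordEval_of_forall_lt (w : List (Fin N)) (hw : ∀ i ∈ w, (i : ℕ) < N₁) (x : R) :
    wordEval N₁ N₂ g ℓ w x = (w.map ℓ).prod * x := by
  induction w with
  | nil => simp
  | cons i w ih =>
    rw [wordEval_cons, ih fun j hj => hw j (List.mem_cons_of_mem _ hj)]
    simp [letterMap, hw i, mul_assoc]

end wordEval

theorem proj_eq_wordEval {N : ℕ} (N₁ N₂ : ℕ) (γ lam : Fin N → ℝ) (w : List (Fin N)) :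
    proj N₁ N₂ γ lam w = wordEval N₁ N₂ γ lam w 0 := by
  unfold proj wordMap wordEval
  congr 1
  funext i x
  unfold ifsMap letterMap
  split_ifs <;> ring

/-- With every symbol put into `I₀` all maps are linear; the Taylor bounds for word values thereby
cover ratios too. -/
theorem wordRatio_eq_wordEval {N : ℕ} (γ lam : Fin N → ℝ) (w : List (Fin N)) :
    wordRatio lam w = wordEval N N γ lam w 1 := by
  rw [wordEval_of_forall_lt _ _ _ fun i _ => i.2, mul_one]; rfl

/-- The point `x` shifted by an indeterminate in the direction `k`. -/
def shift {N : ℕ} (k : Fin N) (x : Fin N → ℝ) (i : Fin N) : ℝ[X] :=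
  if i = k then X + C (x i) else C (x i)

/-- The Taylor expansion in the direction `k` of the map `x ↦ wordEval N₁ N₂ γ x w z`. -/
def wordTaylor {N : ℕ} (N₁ N₂ : ℕ) (γ : Fin N → ℝ) (k : Fin N) (z : ℝ) (w : List (Fin N))
    (x : Fin N → ℝ) : ℝ[X] :=
  wordEval N₁ N₂ (fun i => C (γ i)) (shift k x) w (C z)

theorem coeff_zero_wordTaylor {N : ℕ} (N₁ N₂ : ℕ) (γ : Fin N → ℝ) (k : Fin N) (z : ℝ)
    (w : List (Fin N)) (x : Fin N → ℝ) :
    (wordTaylor N₁ N₂ γ k z w x).coeff 0 = wordEval N₁ N₂ γ x w z := by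
  rw [coeff_zero_eq_eval_zero, ← coe_evalRingHom, wordTaylor, map_wordEval]
  congr 1
  · funext i; simp
  · funext i; unfold shift; split_ifs <;> simp
  · simp

/-- Bounds on the unit cube for a family of polynomials behaving like Taylor expansions in the
direction `k`. -/
structure TaylorBound {N : ℕ} (k : Fin N) (B : ℝ) (P : (Fin N → ℝ) → ℝ[X]) : Prop where
  abs_le : ∀ l, ∀ x ∈ unitCube N, |(P x).coeff l| ≤ B
  lipschitz : ∀ l, ∀ x ∈ unitCube N, ∀ y ∈ unitCube N,
    |(P x).coeff l - (P y).coeff l| ≤ B * ‖x - y‖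
  taylor : ∀ l : ℕ, ∀ x ∈ unitCube N, ∀ y ∈ unitCube N, (∀ i, i ≠ k → x i = y i) →
    |(P y).coeff l - (P x).coeff l - (l + 1) * (P x).coeff (l + 1) * (y k - x k)| ≤
      B * (y k - x k) ^ 2

namespace TaylorBound

variable {N : ℕ} {k : Fin N} {B B' : ℝ} {P Q : (Fin N → ℝ) → ℝ[X]}

theorem mono (h : TaylorBound k B P) (hB : B ≤ B') : TaylorBound k B' P where
  abs_le l x hx := (h.abs_le l x hx).trans hB
  lipschitz l x hx y hy := (h.lipschitz l x hx y hy).trans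
    (mul_le_mul_of_nonneg_right hB (norm_nonneg _))
  taylor l x hx y hy hxy := (h.taylor l x hx y hy hxy).trans
    (mul_le_mul_of_nonneg_right hB (sq_nonneg _))

theorem const (k : Fin N) (z : ℝ) : TaylorBound k |z| fun _ => C z where
  abs_le l x _ := by
    rw [coeff_C]; split_ifs <;> simp
  lipschitz l x _ y _ := by simp; positivity
  taylor l x _ y _ _ := by simp [coeff_C]; positivity

theorem neg (h : TaylorBound k B P) : TaylorBound k B fun x => -P x where
  abs_le l x hx := by simpa using h.abs_le l x hx
  lipschitz l x hx y hy := by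
    rw [coeff_neg, coeff_neg, ← abs_neg]
    convert h.lipschitz l x hx y hy using 2; ring
  taylor l x hx y hy hxy := by
    rw [coeff_neg, coeff_neg, coeff_neg, ← abs_neg]
    convert h.taylor l x hx y hy hxy using 2; ring

theorem add (h : TaylorBound k B P) (h' : TaylorBound k B' Q) :
    TaylorBound k (B + B') fun x => P x + Q x where
  abs_le l x hx := by
    rw [coeff_add]
    exact (abs_add_le _ _).trans (add_le_add (h.abs_le l x hx) (h'.abs_le l x hx))
  lipschitz l x hx y hy := by
    rw [coeff_add, coeff_add, add_mul]
    refine le_trans ?_ (add_le_add (h.lipschitz l x hx y hy) (h'.lipschitz l x hx y hy))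
    refine le_trans (le_of_eq ?_) (abs_add_le _ _)
    congr 1; ring
  taylor l x hx y hy hxy := by
    rw [coeff_add, coeff_add, coeff_add, add_mul B B']
    refine le_trans ?_ (add_le_add (h.taylor l x hx y hy hxy) (h'.taylor l x hx y hy hxy))
    refine le_trans (le_of_eq ?_) (abs_add_le _ _)
    congr 1; ring

theorem sub (h : TaylorBound k B P) (h' : TaylorBound k B' Q) :
    TaylorBound k (B + B') fun x => P x - Q x := by
  simpa [sub_eq_add_neg] using h.add h'.neg

theorem C_mul (h : TaylorBound k B P) {i : Fin N} (hi : i ≠ k) (hB : 0 ≤ B) :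
    TaylorBound k (3 * B) fun x => C (x i) * P x where
  abs_le l x hx := by
    rw [coeff_C_mul, abs_mul, abs_of_pos (hx i).1]
    nlinarith [h.abs_le l x hx, (hx i).1, (hx i).2, abs_nonneg ((P x).coeff l)]
  lipschitz l x hx y hy := by
    rw [coeff_C_mul, coeff_C_mul]
    have e : x i * (P x).coeff l - y i * (P y).coeff l =
      x i * ((P x).coeff l - (P y).coeff l) + (x i - y i) * (P y).coeff l := by ring
    rw [e]
    refine (abs_add_le _ _).trans ?_
    rw [abs_mul, abs_mul, abs_of_pos (hx i).1]
    have h1 := h.lipschitz l x hx y hy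
    have h2 := h.abs_le l y hy
    have h3 : |x i - y i| ≤ ‖x - y‖ := norm_le_pi_norm (x - y) i
    have h4 : |x i - y i| * |(P y).coeff l| ≤ ‖x - y‖ * B :=
      mul_le_mul h3 h2 (abs_nonneg _) (norm_nonneg _)
    have h5 : x i * |(P x).coeff l - (P y).coeff l| ≤ 1 * (B * ‖x - y‖) :=
      mul_le_mul (hx i).2.le h1 (abs_nonneg _) zero_le_one
    have h6 : 0 ≤ B * ‖x - y‖ := by positivity
    linarith
  taylor l x hx y hy hxy := by
    rw [coeff_C_mul, coeff_C_mul, coeff_C_mul, ← hxy i hi]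
    have e : x i * (P y).coeff l - x i * (P x).coeff l -
        (l + 1) * (x i * (P x).coeff (l + 1)) * (y k - x k) =
      x i * ((P y).coeff l - (P x).coeff l - (l + 1) * (P x).coeff (l + 1) * (y k - x k)) := by
      ring
    rw [e, abs_mul, abs_of_pos (hx i).1]
    have h1 := h.taylor l x hx y hy hxy
    have h5 := mul_le_mul (hx i).2.le h1 (abs_nonneg _) zero_le_one
    have h6 : 0 ≤ B * (y k - x k) ^ 2 := by positivity
    linarith

/-- The new `l`-th coefficient is the old one of index `l - 1` plus `x k` times the old `l`-th. The
first summand costs `B`, the product at most `2 * B` by the product rule. -/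
theorem X_mul (h : TaylorBound k B P) (hB : 0 ≤ B) :
    TaylorBound k (3 * B) fun x => (X + C (x k)) * P x where
  abs_le l x hx := by
    have h1 : |x k * (P x).coeff l| ≤ B := by
      rw [abs_mul, abs_of_pos (hx k).1]
      nlinarith [h.abs_le l x hx, (hx k).1, (hx k).2, abs_nonneg ((P x).coeff l)]
    rw [add_mul, coeff_add, coeff_C_mul]
    rcases l with _ | l
    · rw [coeff_X_mul_zero, zero_add]; linarith
    · rw [coeff_X_mul]
      have := abs_add_le ((P x).coeff l) (x k * (P x).coeff (l + 1))
      linarith [h.abs_le l x hx]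
  lipschitz l x hx y hy := by
    have h0 : |x k * (P x).coeff l - y k * (P y).coeff l| ≤ 2 * (B * ‖x - y‖) := by
      have e : x k * (P x).coeff l - y k * (P y).coeff l =
        x k * ((P x).coeff l - (P y).coeff l) + (x k - y k) * (P y).coeff l := by ring
      rw [e]
      refine (abs_add_le _ _).trans ?_
      rw [abs_mul, abs_mul, abs_of_pos (hx k).1]
      have h1 := h.lipschitz l x hx y hy
      have h2 := h.abs_le l y hy
      have h3 : |x k - y k| ≤ ‖x - y‖ := norm_le_pi_norm (x - y) k
      have h4 : |x k - y k| * |(P y).coeff l| ≤ ‖x - y‖ * B :=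
        mul_le_mul h3 h2 (abs_nonneg _) (norm_nonneg _)
      have h5 : x k * |(P x).coeff l - (P y).coeff l| ≤ 1 * (B * ‖x - y‖) :=
        mul_le_mul (hx k).2.le h1 (abs_nonneg _) zero_le_one
      linarith
    have h6 : 0 ≤ B * ‖x - y‖ := by positivity
    rw [add_mul, add_mul, coeff_add, coeff_add, coeff_C_mul, coeff_C_mul]
    rcases l with _ | l
    · rw [coeff_X_mul_zero, coeff_X_mul_zero, zero_add, zero_add]; linarith
    · rw [coeff_X_mul, coeff_X_mul, add_sub_add_comm]
      have := abs_add_le ((P x).coeff l - (P y).coeff l)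
        (x k * (P x).coeff (l + 1) - y k * (P y).coeff (l + 1))
      linarith [h.lipschitz l x hx y hy]
  taylor l x hx y hy hxy := by
    have hnorm : ‖x - y‖ ≤ |y k - x k| := by
      rw [pi_norm_le_iff_of_nonneg (abs_nonneg _)]
      intro i
      by_cases hi : i = k
      · subst hi; rw [abs_sub_comm]; rfl
      · simp [hxy i hi]
    have h0 : |y k * (P y).coeff l - x k * (P x).coeff l -
        ((l + 1) * (x k * (P x).coeff (l + 1)) + (P x).coeff l) * (y k - x k)| ≤
        2 * (B * (y k - x k) ^ 2) := by
      have e : y k * (P y).coeff l - x k * (P x).coeff l -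
          ((l + 1) * (x k * (P x).coeff (l + 1)) + (P x).coeff l) * (y k - x k) =
        x k * ((P y).coeff l - (P x).coeff l - (l + 1) * (P x).coeff (l + 1) * (y k - x k)) +
          (y k - x k) * -((P x).coeff l - (P y).coeff l) := by ring
      rw [e]
      refine (abs_add_le _ _).trans ?_
      rw [abs_mul, abs_mul, abs_of_pos (hx k).1, abs_neg]
      have h1 := h.taylor l x hx y hy hxy
      have h2 := (h.lipschitz l x hx y hy).trans (mul_le_mul_of_nonneg_left hnorm hB)
      have h5 := mul_le_mul (hx k).2.le h1 (abs_nonneg _) zero_le_one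
      have h7 := mul_le_mul_of_nonneg_left h2 (abs_nonneg (y k - x k))
      have h8 : |y k - x k| * (B * |y k - x k|) = B * (y k - x k) ^ 2 := by
        rw [← sq_abs]; ring
      linarith
    have h6 : 0 ≤ B * (y k - x k) ^ 2 := by positivity
    rw [add_mul, add_mul, coeff_add, coeff_add, coeff_add, coeff_C_mul, coeff_C_mul, coeff_C_mul]
    rcases l with _ | l
    · rw [coeff_X_mul_zero, coeff_X_mul_zero, zero_add, zero_add, coeff_X_mul]
      refine le_trans (le_of_eq ?_) (h0.trans (by linarith))
      congr 1; push_cast; ring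
    · rw [coeff_X_mul, coeff_X_mul, coeff_X_mul]
      have h1 := h.taylor l x hx y hy hxy
      refine le_trans (le_of_eq ?_) ((abs_add_le _ _).trans ((add_le_add h1 h0).trans (by linarith)))
      congr 1; push_cast; ring

theorem shift_mul (h : TaylorBound k B P) (i : Fin N) (hB : 0 ≤ B) :
    TaylorBound k (3 * B) fun x => shift k x i * P x := by
  by_cases hi : i = k
  · subst hi; simpa [shift] using h.X_mul hB
  · simpa [shift, hi] using h.C_mul hi hB

end TaylorBound

theorem taylorBound_wordTaylor {N : ℕ} (N₁ N₂ : ℕ) (γ : Fin N → ℝ) (k : Fin N) {z Γ : ℝ}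
    (hz : |z| ≤ Γ) (hγ : ∀ i, |γ i| ≤ Γ) (w : List (Fin N)) :
    TaylorBound k (Γ * 8 ^ w.length) (wordTaylor N₁ N₂ γ k z w) := by
  have hΓ : 0 ≤ Γ := (abs_nonneg z).trans hz
  induction w with
  | nil =>
    rw [List.length_nil, pow_zero, mul_one]
    exact (TaylorBound.const k z).mono hz
  | cons i w ih =>
    have hB : 0 ≤ Γ * 8 ^ w.length := by positivity
    have hle : Γ ≤ Γ * 8 ^ w.length := le_mul_of_one_le_right hΓ (one_le_pow₀ (by norm_num))
    have hi : TaylorBound k (Γ * 8 ^ w.length) fun _ => C (γ i) :=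
      (TaylorBound.const k (γ i)).mono ((hγ i).trans hle)
    have hlen : Γ * 8 ^ (i :: w).length = 8 * (Γ * 8 ^ w.length) := by
      rw [List.length_cons, pow_succ]; ring
    rw [hlen]
    change TaylorBound k _ fun x =>
      letterMap N₁ N₂ (fun i => C (γ i)) (shift k x) i (wordTaylor N₁ N₂ γ k z w x)
    unfold letterMap
    split_ifs
    · exact (ih.shift_mul i hB).mono (by linarith)
    · exact ((ih.add hi).shift_mul i (by positivity)).mono (by linarith)
    · exact ((ih.neg.add hi).shift_mul i (by positivity)).mono (by linarith)

end CFS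
end

/-! ### Combinatorics of blocks: same block structure or a splitting. -/

noncomputable section

namespace CFS

section blocks

variable {N : ℕ} {N₁ : ℕ}

theorem blocks_append {w v : List (Fin N)}
    (h : ∀ x ∈ w.getLast?, ∀ y ∈ v.head?, x ≠ y ∧ ¬ ((x : ℕ) < N₁ ∧ (y : ℕ) < N₁)) :
    blocks N₁ (w ++ v) = blocks N₁ w ++ blocks N₁ v := by
  refine List.splitBy_append fun x hx y hy => ?_
  have := h x hx y hy
  simp only [decide_eq_false_iff_not, not_or]
  exact this

theorem blocks_of_forall_lt {w : List (Fin N)} (hw : ∀ i ∈ w, (i : ℕ) < N₁) (h0 : w ≠ []) :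
    blocks N₁ w = [w] := by
  refine List.splitBy_of_isChain h0 ?_
  refine List.Pairwise.isChain ?_
  rw [List.pairwise_iff_forall_sublist]
  intro a b hab
  have ha := hw a (hab.subset (by simp))
  have hb := hw b (hab.subset (by simp))
  simp [ha, hb]

theorem blocks_replicate (s : Fin N) {p : ℕ} (hp : p ≠ 0) :
    blocks N₁ (List.replicate p s) = [List.replicate p s] := by
  refine List.splitBy_of_isChain (by simpa using hp) ?_
  refine List.Pairwise.isChain ?_
  rw [List.pairwise_replicate]
  simp

theorem sameBlockStructure_nil : SameBlockStructure N₁ ([] : List (Fin N)) [] := by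
  simp [SameBlockStructure, blocks]

theorem sameBlockStructure_of_perm {a b : List (Fin N)} (ha : ∀ i ∈ a, (i : ℕ) < N₁)
    (hab : a.Perm b) : SameBlockStructure N₁ a b := by
  by_cases h0 : a = []
  · subst h0
    rw [List.nil_perm.1 hab]
    exact sameBlockStructure_nil
  · have h0' : b ≠ [] := fun h => h0 (by subst h; exact List.perm_nil.1 hab)
    rw [SameBlockStructure, blocks_of_forall_lt ha h0,
      blocks_of_forall_lt (fun i hi => ha i (hab.mem_iff.2 hi)) h0']
    simp [hab.count_eq]

theorem SameBlockStructure.append {w w' v v' : List (Fin N)} (h : SameBlockStructure N₁ w w')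
    (h' : SameBlockStructure N₁ v v')
    (hwv : ∀ x ∈ w.getLast?, ∀ y ∈ v.head?, x ≠ y ∧ ¬ ((x : ℕ) < N₁ ∧ (y : ℕ) < N₁))
    (hwv' : ∀ x ∈ w'.getLast?, ∀ y ∈ v'.head?, x ≠ y ∧ ¬ ((x : ℕ) < N₁ ∧ (y : ℕ) < N₁)) :
    SameBlockStructure N₁ (w ++ v) (w' ++ v') := by
  unfold SameBlockStructure at *
  rw [blocks_append hwv, blocks_append hwv']
  exact List.rel_append h h'

theorem sameBlockStructure_replicate (s : Fin N) (p : ℕ) :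
    SameBlockStructure N₁ (List.replicate p s) (List.replicate p s) := by
  by_cases hp : p = 0
  · subst hp; exact sameBlockStructure_nil
  · rw [SameBlockStructure, blocks_replicate s hp]
    simp

end blocks

/-- The difference of the values of two words factors, up to sign, as a monomial times a difference
`A - B` such that `B` vanishes when the `k`-th contraction ratio is `0` while `A` does not. -/
def SplitsAt {N : ℕ} (N₁ N₂ : ℕ) (k : Fin N) (w v : List (Fin N)) : Prop :=
  ∃ (pre a b u u' : List (Fin N)) (s s' : Fin N) (e : ℕ),
    pre.length ≤ w.length ∧ b.length ≤ w.length ∧ N₁ ≤ (s : ℕ) ∧ N₁ ≤ (s' : ℕ) ∧ s ≠ k ∧ k ∉ b ∧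
    (k ∈ a ∨ s' = k) ∧
    ∀ (R : Type) [CommRing R] (g ℓ : Fin N → R),
      wordEval N₁ N₂ g ℓ w 0 - wordEval N₁ N₂ g ℓ v 0 =
        (-1) ^ e * (pre.map ℓ).prod *
          ((b.map ℓ).prod * wordEval N₁ N₂ g ℓ (s :: u) 0 -
            (a.map ℓ).prod * wordEval N₁ N₂ g ℓ (s' :: u') 0)

section splits

variable {N : ℕ} {N₁ N₂ : ℕ}

theorem SplitsAt.symm {k : Fin N} {w v : List (Fin N)} (h : SplitsAt N₁ N₂ k w v)
    (hl : w.length = v.length) : SplitsAt N₁ N₂ k v w := by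
  obtain ⟨pre, a, b, u, u', s, s', e, h1, h2, h3, h4, h5, h6, h7, h8⟩ := h
  refine ⟨pre, a, b, u, u', s, s', e + 1, hl ▸ h1, hl ▸ h2, h3, h4, h5, h6, h7, ?_⟩
  intro R _ g ℓ
  rw [← neg_sub, h8 R g ℓ]; ring

/-- Each letter is affine with slope plus or minus its ratio, and the sign depends only on the
letter, so `e` can be chosen before the ring. -/
theorem exists_wordEval_sub_wordEval (q : List (Fin N)) : ∃ e : ℕ, ∀ (R : Type) [CommRing R]
    (g ℓ : Fin N → R) (x y : R), wordEval N₁ N₂ g ℓ q x - wordEval N₁ N₂ g ℓ q y =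
      (-1) ^ e * (q.map ℓ).prod * (x - y) := by
  induction q with
  | nil => exact ⟨0, fun R _ g ℓ x y => by simp⟩
  | cons i q ih =>
    obtain ⟨e, he⟩ := ih
    by_cases hi : (i : ℕ) < N₂ ∨ (i : ℕ) < N₁
    · refine ⟨e, fun R _ g ℓ x y => ?_⟩
      have := he R g ℓ x y
      simp only [wordEval_cons, letterMap, List.map_cons, List.prod_cons]
      split_ifs with h1 h2
      · linear_combination ℓ i * this
      · linear_combination ℓ i * this
      · tauto
    · refine ⟨e + 1, fun R _ g ℓ x y => ?_⟩
      push Not at hi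
      have := he R g ℓ x y
      simp only [wordEval_cons, letterMap, List.map_cons, List.prod_cons, not_lt.2 hi.1,
        not_lt.2 hi.2, if_false]
      linear_combination -ℓ i * this

theorem SplitsAt.prepend {k : Fin N} {w v : List (Fin N)} (h : SplitsAt N₁ N₂ k w v)
    {q q' : List (Fin N)} (hq : ∀ (R : Type) [CommRing R] (g ℓ : Fin N → R) (x : R),
      wordEval N₁ N₂ g ℓ q x = wordEval N₁ N₂ g ℓ q' x) :
    SplitsAt N₁ N₂ k (q ++ w) (q' ++ v) := by
  obtain ⟨pre, a, b, u, u', s, s', e, h1, h2, h3, h4, h5, h6, h7, h8⟩ := h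
  obtain ⟨e', he'⟩ := exists_wordEval_sub_wordEval (N₁ := N₁) (N₂ := N₂) q
  refine ⟨q ++ pre, a, b, u, u', s, s', e' + e, ?_, ?_, h3, h4, h5, h6, h7, ?_⟩
  · simpa using h1
  · rw [List.length_append]; omega
  · intro R _ g ℓ
    rw [wordEval_append, wordEval_append, ← hq, he', h8, List.map_append, List.prod_append]
    ring

theorem prod_map_eq_pow_count_mul {R : Type*} [CommRing R] (ℓ : Fin N → R) (k : Fin N)
    (b : List (Fin N)) :
    (b.map ℓ).prod = ℓ k ^ b.count k * ((b.filter (· ≠ k)).map ℓ).prod := by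
  induction b with
  | nil => simp
  | cons i b ih =>
    by_cases hi : i = k
    · subst hi
      rw [List.map_cons, List.prod_cons, ih, List.count_cons_self, List.filter_cons_of_neg (by simp)]
      ring
    · rw [List.map_cons, List.prod_cons, ih, List.count_cons_of_ne hi,
        List.filter_cons_of_pos (by simpa using hi), List.map_cons, List.prod_cons]
      ring

/-- The common power of `k` is cancelled, leaving a positive power of `k` on one side only. Since
`k` is in `I₀`, it differs from `s`. -/
theorem splitsAt_of_count_lt {a b w v : List (Fin N)} {k s s' : Fin N} (ha : ∀ i ∈ a, (i : ℕ) < N₁)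
    (hb : ∀ i ∈ b, (i : ℕ) < N₁) (hs : N₁ ≤ (s : ℕ)) (hs' : N₁ ≤ (s' : ℕ))
    (hk : b.count k < a.count k) (hl : (a ++ s' :: w).length = (b ++ s :: v).length) :
    SplitsAt N₁ N₂ k (a ++ s' :: w) (b ++ s :: v) := by
  have hka : k ∈ a := List.count_pos_iff.1 (by omega)
  have hk1 := ha k hka
  refine ⟨List.replicate (b.count k) k,
    List.replicate (a.count k - b.count k) k ++ a.filter (· ≠ k), b.filter (· ≠ k), v, w, s, s', 1,
    ?_, ?_, hs, hs', ?_, by simp, Or.inl ?_, ?_⟩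
  · rw [List.length_replicate, hl, List.length_append]
    have := List.count_le_length (a := k) (l := b)
    omega
  · rw [hl, List.length_append]
    have := List.length_filter_le (· ≠ k) b
    omega
  · rintro rfl; omega
  · exact List.mem_append_left _ (by simp; omega)
  · intro R _ g ℓ
    rw [wordEval_append, wordEval_append, wordEval_of_forall_lt _ _ _ ha,
      wordEval_of_forall_lt _ _ _ hb, prod_map_eq_pow_count_mul ℓ k a,
      prod_map_eq_pow_count_mul ℓ k b, List.map_append, List.prod_append, List.map_replicate,
      List.map_replicate, List.prod_replicate, List.prod_replicate]
    have : ℓ k ^ a.count k = ℓ k ^ b.count k * ℓ k ^ (a.count k - b.count k) := by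
      rw [← pow_add]; congr 1; omega
    rw [this]; ring

/-- Neither word can end with its `I₀`-prefix: a letter outside `I₀` in the other word would have to
occur in that prefix. -/
theorem exists_splitsAt_of_prefix {a b w v : List (Fin N)} (ha : ∀ i ∈ a, (i : ℕ) < N₁)
    (hb : ∀ i ∈ b, (i : ℕ) < N₁) (hw : ∀ x ∈ w.head?, N₁ ≤ (x : ℕ))
    (hv : ∀ x ∈ v.head?, N₁ ≤ (x : ℕ)) (hp : (a ++ w).Perm (b ++ v)) (hab : ¬ a.Perm b) :
    ∃ k, SplitsAt N₁ N₂ k (a ++ w) (b ++ v) := by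
  obtain ⟨k, hk⟩ : ∃ k, a.count k ≠ b.count k := by
    by_contra! h
    exact hab (List.perm_iff_count.2 h)
  rcases w with _ | ⟨s', w⟩
  · rcases v with _ | ⟨s, v⟩
    · simp at hp; exact absurd hp hab
    · have h1 : s ∈ a ++ [] := hp.mem_iff.2 (by simp)
      have := ha s (by simpa using h1)
      have := hv s (by simp)
      omega
  rcases v with _ | ⟨s, v⟩
  · have h1 : s' ∈ b ++ [] := hp.mem_iff.1 (by simp)
    have := hb s' (by simpa using h1)
    have := hw s' (by simp)
    omega
  have hs := hv s (by simp)
  have hs' := hw s' (by simp)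
  rcases Nat.lt_or_gt_of_ne hk with h | h
  · exact ⟨k, (splitsAt_of_count_lt hb ha hs' hs h hp.length_eq.symm).symm hp.length_eq.symm⟩
  · exact ⟨k, splitsAt_of_count_lt ha hb hs hs' h hp.length_eq⟩

/-- Outside `I₀` too, a map has its own ratio as a factor, so the value starting with `s'` vanishes
at ratio zero of `s'`. -/
theorem splitsAt_of_ne {w v : List (Fin N)} {s s' : Fin N} (hs : N₁ ≤ (s : ℕ))
    (hs' : N₁ ≤ (s' : ℕ)) (hne : s ≠ s') : SplitsAt N₁ N₂ s' (s :: w) (s' :: v) :=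
  ⟨[], [], [], w, v, s, s', 0, by simp, by simp, hs, hs', hne, by simp, Or.inr rfl,
    fun R _ g ℓ => by simp⟩

theorem exists_maximal_prefix (p : Fin N → Prop) (w : List (Fin N)) :
    ∃ a w', w = a ++ w' ∧ (∀ i ∈ a, p i) ∧ ∀ x ∈ w'.head?, ¬ p x := by
  classical
  refine ⟨w.takeWhile (fun i => decide (p i)), w.dropWhile (fun i => decide (p i)),
    List.takeWhile_append_dropWhile.symm, fun i hi => ?_, fun x hx => ?_⟩
  · simpa using List.mem_takeWhile_imp hi
  · have := List.head?_dropWhile_not (fun i => decide (p i)) w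
    rw [Option.mem_def.1 hx] at this
    simpa using this

theorem exists_splitsAt_of_run {w v : List (Fin N)} {s : Fin N} (hs : N₁ ≤ (s : ℕ))
    (hw : ∀ x ∈ w.head?, x ≠ s) (hp : w.Perm (s :: v)) :
    ∃ k, SplitsAt N₁ N₂ k w (s :: v) := by
  rcases w with _ | ⟨x, w⟩
  · simp at hp
  have hx : x ≠ s := hw x (by simp)
  by_cases hxN : (x : ℕ) < N₁
  · obtain ⟨a, w', hw', ha, hh⟩ := exists_maximal_prefix (fun i : Fin N => (i : ℕ) < N₁) (x :: w)
    rw [hw'] at hp ⊢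
    refine exists_splitsAt_of_prefix (b := []) ha (by simp) (fun y hy => not_lt.1 (hh y hy))
      (by simpa using hs) hp ?_
    intro h
    rw [List.perm_nil] at h
    subst h
    rw [List.nil_append] at hw'
    exact hh x (by simp [← hw']) hxN
  · exact ⟨s, splitsAt_of_ne (not_lt.1 hxN) hs hx⟩

theorem eq_replicate_of_prefix (s : Fin N) (w : List (Fin N)) :
    ∃ p w', w = List.replicate p s ++ w' ∧ ∀ x ∈ w'.head?, x ≠ s := by
  obtain ⟨a, w', h1, h2, h3⟩ := exists_maximal_prefix (fun i => i = s) w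
  exact ⟨a.length, w', by rw [← List.eq_replicate_of_mem h2]; exact h1, h3⟩

/-- The words are compared block by block. The first discrepancy, in the content of an `I₀`-block,
in a letter outside `I₀` or in the length of its run, yields a splitting, and prepending the
equivalent earlier part preserves it. -/
theorem sameBlockStructure_or_splitsAt (n : ℕ) : ∀ w v : List (Fin N), w.length ≤ n → w.Perm v →
    SameBlockStructure N₁ w v ∨ ∃ k, SplitsAt N₁ N₂ k w v := by
  induction n with
  | zero =>
    intro w v hn hp
    have hw : w = [] := List.eq_nil_of_length_eq_zero (by omega)
    subst hw
    rw [List.nil_perm.1 hp]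
    exact Or.inl sameBlockStructure_nil
  | succ n ih =>
    intro w v hn hp
    obtain ⟨a, w', rfl, ha, hw'⟩ := exists_maximal_prefix (fun i : Fin N => (i : ℕ) < N₁) w
    obtain ⟨b, v', rfl, hb, hv'⟩ := exists_maximal_prefix (fun i : Fin N => (i : ℕ) < N₁) v
    by_cases hab : a.Perm b
    swap
    · exact Or.inr (exists_splitsAt_of_prefix ha hb (fun y hy => not_lt.1 (hw' y hy))
        (fun y hy => not_lt.1 (hv' y hy)) hp hab)
    have hp' : w'.Perm v' := (List.perm_append_left_iff b).1 ((hab.symm.append_right w').trans hp)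
    have hq : ∀ (R : Type) [CommRing R] (g ℓ : Fin N → R) (x : R),
        wordEval N₁ N₂ g ℓ a x = wordEval N₁ N₂ g ℓ b x := fun R _ g ℓ x => by
      rw [wordEval_of_forall_lt _ _ _ ha, wordEval_of_forall_lt _ _ _ hb,
        (hab.map ℓ).prod_eq]
    rcases w' with _ | ⟨s, w1⟩
    · rw [List.nil_perm.1 hp', List.append_nil, List.append_nil]
      exact Or.inl (sameBlockStructure_of_perm ha hab)
    rcases v' with _ | ⟨t, v1⟩
    · simp at hp'
    have hs : N₁ ≤ (s : ℕ) := not_lt.1 (hw' s (by simp))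
    have ht : N₁ ≤ (t : ℕ) := not_lt.1 (hv' t (by simp))
    by_cases hst : s = t
    swap
    · exact Or.inr ⟨t, (splitsAt_of_ne hs ht hst).prepend hq⟩
    subst hst
    have hp1 : w1.Perm v1 := (List.perm_cons s).1 hp'
    obtain ⟨p, w2, rfl, hw2⟩ := eq_replicate_of_prefix s w1
    obtain ⟨q, v2, rfl, hv2⟩ := eq_replicate_of_prefix s v1
    simp only [← List.cons_append, ← List.replicate_succ]
    have hrun : ∀ (m : ℕ) (c : List (Fin N)), (∀ i ∈ c, (i : ℕ) < N₁) →
        ∀ x ∈ c.getLast?, ∀ y ∈ (List.replicate (m + 1) s).head?,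
          x ≠ y ∧ ¬ ((x : ℕ) < N₁ ∧ (y : ℕ) < N₁) := by
      intro m c hc x hx y hy
      have hx' := hc x (List.mem_of_getLast? hx)
      have hy' : y = s := by simpa [List.replicate_succ] using hy.symm
      subst hy'
      exact ⟨fun h => by subst h; omega, by omega⟩
    have hrun' : ∀ (m : ℕ) (c : List (Fin N)), (∀ x ∈ c.head?, x ≠ s) →
        ∀ x ∈ (List.replicate (m + 1) s).getLast?, ∀ y ∈ c.head?,
          x ≠ y ∧ ¬ ((x : ℕ) < N₁ ∧ (y : ℕ) < N₁) := by
      intro m c hc x hx y hy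
      have hx' : x = s := List.eq_of_mem_replicate (List.mem_of_getLast? hx)
      subst hx'
      exact ⟨(hc y hy).symm, by omega⟩
    -- The runs have lengths `p + 1` and `q + 1`. If these differ, removing the shorter run from
    -- both leaves one word starting with `s` and one not.
    rcases lt_trichotomy p q with hpq | rfl | hpq
    · obtain ⟨r, rfl⟩ := Nat.exists_eq_add_of_lt hpq
      have e1 : List.replicate (p + r + 1 + 1) s ++ v2 =
          List.replicate (p + 1) s ++ (s :: (List.replicate r s ++ v2)) := by
        rw [← List.cons_append, ← List.replicate_succ, ← List.append_assoc,
          List.replicate_append_replicate]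
        congr 2; omega
      rw [e1]
      have hp2 : w2.Perm (s :: (List.replicate r s ++ v2)) := by
        refine (List.perm_append_left_iff (List.replicate (p + 1) s)).1 ?_
        rw [← e1]
        exact hp'
      obtain ⟨k, hk⟩ := exists_splitsAt_of_run (N₂ := N₂) hs hw2 hp2
      exact Or.inr ⟨k, (hk.prepend fun _ _ _ _ _ => rfl).prepend hq⟩
    · have hp2 : w2.Perm v2 := (List.perm_append_left_iff _).1 hp1
      rcases ih w2 v2 (by simp at hn; omega) hp2 with h | ⟨k, hk⟩
      · left
        refine (sameBlockStructure_of_perm ha hab).append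
          ((sameBlockStructure_replicate s (p + 1)).append h (hrun' p w2 hw2) (hrun' p v2 hv2)) ?_ ?_
        · simpa [List.replicate_succ] using hrun p a ha
        · simpa [List.replicate_succ] using hrun p b hb
      · exact Or.inr ⟨k, (hk.prepend fun _ _ _ _ _ => rfl).prepend hq⟩
    · obtain ⟨r, rfl⟩ := Nat.exists_eq_add_of_lt hpq
      have e1 : List.replicate (q + r + 1 + 1) s ++ w2 =
          List.replicate (q + 1) s ++ (s :: (List.replicate r s ++ w2)) := by
        rw [← List.cons_append, ← List.replicate_succ, ← List.append_assoc,
          List.replicate_append_replicate]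
        congr 2; omega
      rw [e1]
      have hp2 : v2.Perm (s :: (List.replicate r s ++ w2)) := by
        refine (List.perm_append_left_iff (List.replicate (q + 1) s)).1 ?_
        rw [← e1]
        exact hp'.symm
      obtain ⟨k, hk⟩ := exists_splitsAt_of_run (N₂ := N₂) hs hv2 hp2
      exact Or.inr ⟨k, ((hk.symm hp2.length_eq).prepend fun _ _ _ _ _ => rfl).prepend hq⟩

end splits

end CFS
end

/-! ### Compactness and the identity theorem for power series. -/

noncomputable section

namespace CFS

open Polynomial Filter Topology

theorem summable_choose_mul_pow {t : ℝ} (ht0 : 0 ≤ t) (ht1 : t < 1) (i : ℕ) :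
    Summable fun l : ℕ => (l.choose i : ℝ) * t ^ (l - i) := by
  rw [← summable_nat_add_iff i]
  simpa using summable_choose_mul_geometric_of_norm_lt_one (R := ℝ) i
    (show ‖t‖ < 1 by rwa [Real.norm_of_nonneg ht0])

/-- The identity theorem for power series with bounded coefficients, in terms of the Taylor
coefficients at a point of the unit interval. -/
theorem eq_zero_of_forall_tsum_choose {u : ℕ → ℝ} {C t : ℝ} (hu : ∀ l, |u l| ≤ C) (ht0 : 0 < t)
    (ht1 : t < 1) (h : ∀ i : ℕ, ∑' l : ℕ, (l.choose i : ℝ) * t ^ (l - i) * u l = 0) : u 0 = 0 := by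
  set p := FormalMultilinearSeries.ofScalars ℝ u with hp
  have hC : 0 ≤ C := (abs_nonneg _).trans (hu 0)
  have hrad : (1 : ENNReal) ≤ p.radius := by
    have := p.le_radius_of_bound (r := 1) C fun n => by
      rw [hp, FormalMultilinearSeries.ofScalars_norm]
      simpa using hu n
    simpa using this
  have hball := p.hasFPowerSeriesOnBall (lt_of_lt_of_le one_pos hrad)
  have han := hball.analyticOnNhd
  have hsum : ∀ x, p.sum x = ∑' l, u l * x ^ l := fun x => by
    exact (FormalMultilinearSeries.ofScalars_sum_eq (E := ℝ) u x).trans (by simp)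
  have hmem : ∀ x : ℝ, |x| < 1 → x ∈ Metric.eball (0 : ℝ) p.radius := fun x hx => by
    refine Metric.eball_subset_eball hrad ?_
    rw [Metric.mem_eball, edist_dist, dist_zero_right, Real.norm_eq_abs]
    simpa using hx
  have hnear : p.sum =ᶠ[𝓝 t] 0 := by
    filter_upwards [Metric.ball_mem_nhds t (show 0 < 1 - t by linarith)] with x hx
    rw [Metric.mem_ball, Real.dist_eq] at hx
    set y := x - t with hy
    have hxy : x = y + t := by rw [hy]; ring
    rw [hsum, Pi.zero_apply]
    set F : ℕ → ℕ → ℝ := fun l i => y ^ i * ((l.choose i : ℝ) * t ^ (l - i) * u l) with hF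
    have hsupp : ∀ (z v : ℝ) (l i : ℕ), i ∉ Finset.range (l + 1) →
        z ^ i * ((l.choose i : ℝ) * t ^ (l - i) * v) = 0 := fun z v l i hi => by
      rw [Nat.choose_eq_zero_of_lt (by simpa [Nat.lt_succ_iff] using hi)]; simp
    have hrow : ∀ (z v : ℝ) (l : ℕ), ∑' i, z ^ i * ((l.choose i : ℝ) * t ^ (l - i) * v) =
        v * (z + t) ^ l := fun z v l => by
      rw [tsum_eq_sum (hsupp z v l), add_pow, Finset.mul_sum]
      exact Finset.sum_congr rfl fun i _ => by ring
    -- The rows of absolute values are dominated by `C * (|y| + t) ^ l`, and `|y| + t < 1` near `t`;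
    -- this licenses exchanging the sums.
    have hS : Summable (Function.uncurry F) := by
      refine Summable.of_norm_bounded
        (g := fun q : ℕ × ℕ => |y| ^ q.2 * ((q.1.choose q.2 : ℝ) * t ^ (q.1 - q.2) * C)) ?_ ?_
      · refine (summable_prod_of_nonneg fun q => by positivity).2 ⟨fun l => ?_, ?_⟩
        · exact summable_of_ne_finset_zero (s := Finset.range (l + 1)) (hsupp _ _ l)
        · simp_rw [hrow]
          exact (summable_geometric_of_lt_one (by positivity) (by linarith)).mul_left C
      · rintro ⟨l, i⟩
        simp only [Function.uncurry, hF, Real.norm_eq_abs, abs_mul, abs_pow, Nat.abs_cast,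
          abs_of_pos ht0]
        gcongr
        exact hu l
    have hcomm := hS.tsum_comm
    calc ∑' l, u l * x ^ l = ∑' l, ∑' i, F l i := by
          refine tsum_congr fun l => ?_
          rw [hF, hrow, hxy]
      _ = ∑' i, ∑' l, F l i := hcomm.symm
      _ = 0 := by
          simp only [hF, tsum_mul_left, h, mul_zero, tsum_zero]
  have hzero := han.eqOn_zero_of_preconnected_of_eventuallyEq_zero
    (convex_eball (0 : ℝ) p.radius).isPreconnected (hmem t (by rwa [abs_of_pos ht0])) hnear
  have := hzero (hmem 0 (by simp))
  rw [hsum, tsum_eq_single 0 (fun l hl => by simp [hl])] at this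
  simpa using this

/-- Power series with bounded coefficients and constant term bounded below cannot have all their
Taylor coefficients at a point of the unit interval tending to zero. -/
theorem not_forall_tendsto_tsum_choose {u : ℕ → ℕ → ℝ} {C c t : ℝ} (hu : ∀ j l, |u j l| ≤ C)
    (hc : 0 < c) (hu0 : ∀ j, c ≤ u j 0) (ht0 : 0 < t) (ht1 : t < 1)
    (h : ∀ i : ℕ, Tendsto (fun j => ∑' l : ℕ, (l.choose i : ℝ) * t ^ (l - i) * u j l) atTop
      (𝓝 0)) : False := by
  -- Tychonoff gives coefficientwise convergence along a subsequence; dominated convergence carries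
  -- the Taylor coefficients at `t` to the limit.
  obtain ⟨a, ha, φ, hφ, hlim⟩ := (isCompact_univ_pi fun _ : ℕ => isCompact_Icc (a := -C)
    (b := C)).tendsto_subseq (x := u) fun j l _ => abs_le.1 (hu j l)
  have hpt : ∀ l, Tendsto (fun j => u (φ j) l) atTop (𝓝 (a l)) := fun l =>
    (tendsto_pi_nhds.1 hlim l)
  have ha0 : c ≤ a 0 := ge_of_tendsto (hpt 0) (Eventually.of_forall fun j => hu0 _)
  have hzero : a 0 = 0 := by
    refine eq_zero_of_forall_tsum_choose (C := C) (fun l => abs_le.2 (ha l trivial)) ht0 ht1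
      fun i => ?_
    refine tendsto_nhds_unique ?_ ((h i).comp hφ.tendsto_atTop)
    refine tendsto_tsum_of_dominated_convergence
      ((summable_choose_mul_pow ht0.le ht1 i).mul_right C) (fun l => (hpt l).const_mul _)
      (Eventually.of_forall fun j l => ?_)
    rw [Real.norm_eq_abs, abs_mul, abs_of_nonneg (by positivity)]
    gcongr
    exact hu _ l
  linarith

theorem taylor_coeff_eq_tsum (t : ℝ) (p : ℝ[X]) (i : ℕ) :
    (taylor t p).coeff i = ∑' l : ℕ, (l.choose i : ℝ) * t ^ (l - i) * p.coeff l := by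
  rw [taylor_coeff, hasseDeriv_apply, sum_def, eval_finsetSum,
    tsum_eq_sum (s := p.support) fun l hl => by simp [notMem_support_iff.1 hl]]
  exact Finset.sum_congr rfl fun l _ => by rw [eval_monomial]; ring

theorem abs_taylor_coeff_le {t C : ℝ} (ht0 : 0 ≤ t) (ht1 : t < 1) {p : ℝ[X]}
    (hp : ∀ l, |p.coeff l| ≤ C) (i : ℕ) :
    |(taylor t p).coeff i| ≤ (∑' l : ℕ, (l.choose i : ℝ) * t ^ (l - i)) * C := by
  rw [taylor_coeff_eq_tsum, ← Real.norm_eq_abs, ← tsum_mul_right]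
  refine tsum_of_norm_bounded ((summable_choose_mul_pow ht0 ht1 i).mul_right C).hasSum fun l => ?_
  rw [Real.norm_eq_abs, abs_mul, abs_of_nonneg (by positivity)]
  gcongr
  exact hp l

/-- Differences `A - κ X ^ m Q` of polynomials with bounded coefficients which are bounded away from
zero cannot vanish to high order at `t`. -/
theorem not_forall_small_taylor_coeff {t C c : ℝ} (ht0 : 0 < t) (ht1 : t < 1) (hc : 0 < c) :
    ¬ ∀ j : ℕ, ∃ (A Q : ℝ[X]) (κ : ℝ) (m : ℕ), 0 ≤ κ ∧ (∀ l, |A.coeff l| ≤ C) ∧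
      (∀ l, |Q.coeff l| ≤ C) ∧ c ≤ A.coeff 0 ∧ c ≤ A.eval t ∧ c ≤ Q.eval t ∧
      (m ≠ 0 ∨ Q.coeff 0 = 0) ∧
      ∀ i ≤ j, |(taylor t (A - Polynomial.C κ * X ^ m * Q)).coeff i| ≤ 1 / ((j : ℝ) + 1) := by
  intro H
  set E₀ := (∑' l : ℕ, (l.choose 0 : ℝ) * t ^ (l - 0)) * C with hE₀
  set E₁ := (∑' l : ℕ, (l.choose 1 : ℝ) * t ^ (l - 1)) * C with hE₁
  -- `Y` will bound `κ * t ^ m`: a small value at `t` forces `κ * t ^ m * Q(t)` to be close to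
  -- `A(t)`, and `Q(t) ≥ c`.
  set Y := (E₀ + c) / c with hY
  -- `M` will bound `m`: differentiating `X ^ m` produces a factor `m`, while the other terms of the
  -- first derivative are bounded.
  obtain ⟨M, hM⟩ := exists_nat_ge (2 * (1 + E₁ + Y * E₁) / c)
  -- The shift by `J` makes the tolerance at most `c / 2` and the order at least 1, so that the
  -- first derivative is available.
  obtain ⟨J, hJ⟩ := exists_nat_ge (2 / c + 1)
  have hstep : ∀ j : ℕ, ∃ g : ℝ[X], (∀ l, |g.coeff l| ≤ C + Y / t ^ M * C) ∧ c ≤ g.coeff 0 ∧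
      ∀ i ≤ j, |(taylor t g).coeff i| ≤ 1 / ((j : ℝ) + 1) := by
    intro j
    obtain ⟨A, Q, κ, m, hκ, hA, hQ, hA0, hAt, hQt, hm, hsmall⟩ := H (j + J)
    have hJ1 : (1 : ℝ) ≤ J := by have : 0 < 2 / c := by positivity
                                 linarith
    have hJ1' : 1 ≤ J := by exact_mod_cast hJ1
    have hle : 1 / (((j + J : ℕ) : ℝ) + 1) ≤ 1 / ((j : ℝ) + 1) := by
      refine one_div_le_one_div_of_le (by positivity) ?_
      push_cast; linarith
    have hlec : 1 / (((j + J : ℕ) : ℝ) + 1) ≤ c / 2 := by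
      rw [div_le_iff₀ (by positivity)]
      have h2 : 2 / c ≤ (((j + J : ℕ) : ℝ) + 1) := by
        push_cast; have : (0 : ℝ) ≤ j := by positivity
        linarith
      rw [div_le_iff₀ hc] at h2
      linarith
    have hle1 : 1 / (((j + J : ℕ) : ℝ) + 1) ≤ 1 := by
      rw [div_le_iff₀ (by positivity)]
      push_cast; have : (0 : ℝ) ≤ j := by positivity
      linarith
    have hCnn : 0 ≤ C := (abs_nonneg _).trans (hA 0)
    have h0 := (hsmall 0 (by omega)).trans hlec
    have h1 := (hsmall 1 (by omega)).trans hle1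
    have hA0t := abs_taylor_coeff_le ht0.le ht1 hA 0
    have hA1t := abs_taylor_coeff_le ht0.le ht1 hA 1
    have hQ1t := abs_taylor_coeff_le ht0.le ht1 hQ 1
    rw [← hE₀] at hA0t
    rw [← hE₁] at hA1t hQ1t
    rw [taylor_coeff_zero] at hA0t h0
    rw [taylor_coeff_one] at hA1t hQ1t h1
    simp only [eval_sub, eval_mul, eval_C, eval_pow, eval_X, derivative_sub, derivative_mul,
      derivative_C, derivative_X_pow, zero_mul, zero_add, eval_add] at h0 h1
    set y := κ * t ^ m with hy
    have hy0 : 0 ≤ y := by positivity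
    have hE₁0 : 0 ≤ E₁ := (abs_nonneg _).trans hA1t
    have hyQ : y * Q.eval t ≤ E₀ + c := by
      have := (abs_le.1 h0).1
      have := (abs_le.1 hA0t).2
      linarith
    have hyQ' : c / 2 ≤ y * Q.eval t := by
      have := (abs_le.1 h0).2
      linarith
    have hyY : y ≤ Y := by
      rw [hY, le_div_iff₀ hc]
      exact (mul_le_mul_of_nonneg_left hQt hy0).trans hyQ
    have hY0 : 0 ≤ Y := hy0.trans hyY
    have hm' : (m : ℝ) ≤ M := by
      refine le_trans ?_ hM
      rw [le_div_iff₀ hc]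
      have htm : t * (κ * (m * t ^ (m - 1))) = m * y := by
        rcases m with _ | m
        · simp
        · rw [hy, Nat.add_sub_cancel, pow_succ]; ring
      have hb : κ * (m * t ^ (m - 1)) * Q.eval t ≤ 1 + E₁ + Y * E₁ := by
        have e1 := (abs_le.1 h1).1
        have e2 := (abs_le.1 hA1t).2
        have e3 := (abs_le.1 hQ1t).1
        have e4 : y * (derivative Q).eval t ≥ -(Y * E₁) := by
          have : y * E₁ ≤ Y * E₁ := mul_le_mul_of_nonneg_right hyY hE₁0
          have : y * -E₁ ≤ y * (derivative Q).eval t := mul_le_mul_of_nonneg_left e3 hy0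
          linarith
        linarith
      have hb' := mul_le_mul_of_nonneg_left hb ht0.le
      have hb'' : t * (1 + E₁ + Y * E₁) ≤ 1 * (1 + E₁ + Y * E₁) :=
        mul_le_mul_of_nonneg_right ht1.le (by positivity)
      have e5 : t * (κ * (m * t ^ (m - 1)) * Q.eval t) = m * (y * Q.eval t) := by
        rw [← mul_assoc, htm]; ring
      have e6 : (m : ℝ) * (c / 2) ≤ m * (y * Q.eval t) :=
        mul_le_mul_of_nonneg_left hyQ' (by positivity)
      linarith
    have hκ' : κ ≤ Y / t ^ M := by
      rw [le_div_iff₀ (by positivity)]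
      refine le_trans (mul_le_mul_of_nonneg_left ?_ hκ) hyY
      exact pow_le_pow_of_le_one ht0.le ht1.le (by exact_mod_cast hm')
    refine ⟨A - Polynomial.C κ * X ^ m * Q, fun l => ?_, ?_, fun i hi =>
      (hsmall i (by omega)).trans hle⟩
    · rw [coeff_sub, mul_assoc, coeff_C_mul, coeff_X_pow_mul']
      refine (abs_sub _ _).trans (add_le_add (hA l) ?_)
      rw [abs_mul, abs_of_nonneg hκ]
      refine mul_le_mul hκ' ?_ (abs_nonneg _) (by positivity)
      split_ifs
      · exact hQ _
      · simpa using hCnn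
    · rw [coeff_sub, mul_assoc, coeff_C_mul, coeff_X_pow_mul']
      have : (if m ≤ 0 then Q.coeff (0 - m) else 0) = 0 := by
        split_ifs with h
        · have hm0 : m = 0 := by omega
          subst hm0
          simpa using hm
        · rfl
      rw [this]
      linarith
  choose g hg1 hg2 hg3 using hstep
  refine not_forall_tendsto_tsum_choose (u := fun j l => (g j).coeff l) hg1 hc hg2 ht0 ht1
    fun i => ?_
  simp_rw [← taylor_coeff_eq_tsum]
  refine squeeze_zero_norm' ?_ tendsto_one_div_add_atTop_nhds_zero_nat
  filter_upwards [eventually_ge_atTop i] with j hj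
  exact hg3 j i hj

end CFS
end

/-! ### Positivity on the parameter box and transversality at a fixed parameter. -/

noncomputable section

namespace CFS

open Polynomial Filter Topology

/-- Quantitative form, with the factor `θ`, of the conditions on the contraction ratios under which
the interval between `0` and the least `γ k`, `k ∈ I₂`, is mapped into itself. -/
structure Admissible {N : ℕ} (N₁ N₂ : ℕ) (γ ℓ : Fin N → ℝ) (θ : ℝ) : Prop where
  nonneg : ∀ i, 0 ≤ ℓ i
  theta_nonneg : 0 ≤ θ
  theta_le : θ ≤ 1
  le_theta : ∀ i, ℓ i ≤ θ
  le_of_lt : ∀ i : Fin N, N₁ ≤ (i : ℕ) → (i : ℕ) < N₂ → ∀ k : Fin N, N₂ ≤ (k : ℕ) →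
    ℓ i * (γ k + γ i) ≤ θ * γ k
  le_of_le : ∀ i : Fin N, N₂ ≤ (i : ℕ) → ∀ k : Fin N, N₂ ≤ (k : ℕ) → ℓ i * γ i ≤ θ * γ k

section positivity

variable {N N₁ N₂ : ℕ} {γ ℓ : Fin N → ℝ} {θ : ℝ}

/-- Needed because the constant term of a word value in the `k`-th ratio is the value with that
ratio set to zero. -/
theorem Admissible.update_zero (h : Admissible N₁ N₂ γ ℓ θ) (h₁₂ : N₁ ≤ N₂)
    (hγ : ∀ i : Fin N, N₁ ≤ (i : ℕ) → 0 < γ i) (k : Fin N) :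
    Admissible N₁ N₂ γ (Function.update ℓ k 0) θ where
  nonneg i := by
    by_cases hi : i = k
    · subst hi; simp
    · simpa [hi] using h.nonneg i
  theta_nonneg := h.theta_nonneg
  theta_le := h.theta_le
  le_theta i := by
    by_cases hi : i = k
    · subst hi; simpa using h.theta_nonneg
    · simpa [hi] using h.le_theta i
  le_of_lt i h1 h2 j hj := by
    by_cases hi : i = k
    · subst hi
      have := hγ j (h₁₂.trans hj)
      have := h.theta_nonneg
      simp; positivity
    · simpa [hi] using h.le_of_lt i h1 h2 j hj
  le_of_le i h1 j hj := by
    by_cases hi : i = k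
    · subst hi
      have := hγ j (h₁₂.trans hj)
      have := h.theta_nonneg
      simp; positivity
    · simpa [hi] using h.le_of_le i h1 j hj

/-- Every map sends the interval from 0 to the least `γ k` into its `θ`-multiple; in particular the
reversing maps keep values nonnegative. -/
theorem Admissible.wordEval_mem (h : Admissible N₁ N₂ γ ℓ θ) (h₁₂ : N₁ ≤ N₂)
    (hγ : ∀ i : Fin N, N₁ ≤ (i : ℕ) → 0 < γ i) (w : List (Fin N)) :
    0 ≤ wordEval N₁ N₂ γ ℓ w 0 ∧
      ∀ k : Fin N, N₂ ≤ (k : ℕ) → wordEval N₁ N₂ γ ℓ w 0 ≤ θ * γ k := by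
  induction w with
  | nil =>
    refine ⟨le_rfl, fun k hk => ?_⟩
    have := hγ k (h₁₂.trans hk)
    have := h.theta_nonneg
    simp only [wordEval_nil]; positivity
  | cons i w ih =>
    obtain ⟨ih0, ih1⟩ := ih
    rw [wordEval_cons]
    set x := wordEval N₁ N₂ γ ℓ w 0
    have hi := h.nonneg i
    have hx1 : ∀ k : Fin N, N₂ ≤ (k : ℕ) → x ≤ γ k := fun k hk =>
      (ih1 k hk).trans (mul_le_of_le_one_left (hγ k (h₁₂.trans hk)).le h.theta_le)
    unfold letterMap
    split_ifs with h1 h2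
    · refine ⟨by positivity, fun k hk => ?_⟩
      exact mul_le_mul (h.le_theta i) (hx1 k hk) ih0 h.theta_nonneg
    · have := hγ i (not_lt.1 h1)
      refine ⟨by positivity, fun k hk => ?_⟩
      refine (mul_le_mul_of_nonneg_left ?_ hi).trans (h.le_of_lt i (not_lt.1 h1) h2 k hk)
      linarith [hx1 k hk]
    · refine ⟨mul_nonneg hi (by linarith [hx1 i (not_lt.1 h2)]), fun k hk => ?_⟩
      refine (mul_le_mul_of_nonneg_left ?_ hi).trans (h.le_of_le i (not_lt.1 h2) k hk)
      linarith

theorem Admissible.le_wordEval_cons (h : Admissible N₁ N₂ γ ℓ θ) (h₁₂ : N₁ ≤ N₂)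
    (hγ : ∀ i : Fin N, N₁ ≤ (i : ℕ) → 0 < γ i) {s : Fin N} (hs : N₁ ≤ (s : ℕ)) (w : List (Fin N)) :
    ℓ s * γ s * (1 - θ) ≤ wordEval N₁ N₂ γ ℓ (s :: w) 0 := by
  obtain ⟨h0, h1⟩ := h.wordEval_mem h₁₂ hγ w
  rw [wordEval_cons]
  have hs0 := h.nonneg s
  have hγs := hγ s hs
  unfold letterMap
  rw [if_neg (not_lt.2 hs), mul_assoc]
  split_ifs with h2
  · refine mul_le_mul_of_nonneg_left ?_ hs0
    nlinarith [h.theta_nonneg]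
  · refine mul_le_mul_of_nonneg_left ?_ hs0
    linarith [h1 s (not_lt.1 h2)]

theorem eventually_lt_mul {a b : ℝ} (h : a < b) : ∀ᶠ θ : ℝ in 𝓝[<] 1, a ≤ θ * b := by
  have : Tendsto (fun θ : ℝ => θ * b) (𝓝[<] 1) (𝓝 (1 * b)) :=
    (tendsto_id.mono_left nhdsWithin_le_nhds).mul_const b
  rw [one_mul] at this
  exact (this.eventually (lt_mem_nhds h)).mono fun θ hθ => hθ.le

/-- Finitely many strict inequalities survive a factor `θ` close enough to 1. -/
theorem exists_admissible (hℓ : ∀ i, 0 < ℓ i) (hℓ1 : ∀ i, ℓ i < 1)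
    (h1 : ∀ i : Fin N, N₁ ≤ (i : ℕ) → (i : ℕ) < N₂ → ∀ k : Fin N, N₂ ≤ (k : ℕ) →
      ℓ i * (γ k + γ i) < γ k)
    (h2 : ∀ i : Fin N, N₂ ≤ (i : ℕ) → ∀ k : Fin N, N₂ ≤ (k : ℕ) → ℓ i * γ i < γ k) :
    ∃ θ < 1, Admissible N₁ N₂ γ ℓ θ := by
  have e1 : ∀ᶠ θ : ℝ in 𝓝[<] 1, θ < 1 := self_mem_nhdsWithin
  have e2 : ∀ᶠ θ : ℝ in 𝓝[<] 1, 0 ≤ θ := by simpa using eventually_lt_mul zero_lt_one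
  have e3 : ∀ᶠ θ : ℝ in 𝓝[<] 1, ∀ i, ℓ i ≤ θ :=
    eventually_all.2 fun i => by simpa using eventually_lt_mul (hℓ1 i)
  have e4 : ∀ᶠ θ : ℝ in 𝓝[<] 1, ∀ i : Fin N, N₁ ≤ (i : ℕ) → (i : ℕ) < N₂ → ∀ k : Fin N,
      N₂ ≤ (k : ℕ) → ℓ i * (γ k + γ i) ≤ θ * γ k := by
    simp only [eventually_all]
    exact fun i hi hi' k hk => eventually_lt_mul (h1 i hi hi' k hk)
  have e5 : ∀ᶠ θ : ℝ in 𝓝[<] 1, ∀ i : Fin N, N₂ ≤ (i : ℕ) → ∀ k : Fin N,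
      N₂ ≤ (k : ℕ) → ℓ i * γ i ≤ θ * γ k := by
    simp only [eventually_all]
    exact fun i hi k hk => eventually_lt_mul (h2 i hi k hk)
  obtain ⟨θ, a1, a2, a3, a4, a5⟩ := (e1.and (e2.and (e3.and (e4.and e5)))).exists
  exact ⟨θ, a1, ⟨fun i => (hℓ i).le, a2, a1.le, a3, a4, a5⟩⟩

end positivity

section paramBox

variable {N N₁ N₂ : ℕ} {γ : Fin N → ℝ} {lam : EuclideanSpace ℝ (Fin N)}

theorem div_le_iSup_iSup (i : I₁ N₁ N₂ N) (k : I₂ N₂ N) :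
    γ i / γ k ≤ ⨆ i : I₁ N₁ N₂ N, ⨆ k : I₂ N₂ N, γ i / γ k :=
  (le_ciSup (f := fun k : I₂ N₂ N => γ i / γ k) (Set.finite_range _).bddAbove k).trans
    (le_ciSup (f := fun i : I₁ N₁ N₂ N => ⨆ k : I₂ N₂ N, γ i / γ k)
      (Set.finite_range _).bddAbove i)

theorem boundD_le (i k : I₂ N₂ N) : boundD N₂ γ ≤ γ k / γ i :=
  ciInf_le (f := fun p : I₂ N₂ N × I₂ N₂ N => γ p.1 / γ p.2) (Set.finite_range _).bddBelow (k, i)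

theorem boundB_le_one (h₁₂ : N₁ ≤ N₂) (hγ : ∀ i : Fin N, N₁ ≤ (i : ℕ) → 0 < γ i) :
    boundB N₁ N₂ γ ≤ 1 := by
  unfold boundB
  have : 0 ≤ ⨆ i : I₁ N₁ N₂ N, ⨆ k : I₂ N₂ N, γ i / γ k :=
    Real.iSup_nonneg fun i => Real.iSup_nonneg fun k =>
      div_nonneg (hγ i i.2.1).le (hγ k (h₁₂.trans k.2)).le
  rw [div_le_one (by linarith)]
  linarith

theorem mul_lt_of_mem_paramBox (h₁₂ : N₁ ≤ N₂) (hγ : ∀ i : Fin N, N₁ ≤ (i : ℕ) → 0 < γ i)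
    (h : lam ∈ paramBox N₁ N₂ γ) {i : Fin N} (hi : N₁ ≤ (i : ℕ)) (hi' : (i : ℕ) < N₂) {k : Fin N}
    (hk : N₂ ≤ (k : ℕ)) : lam i * (γ k + γ i) < γ k := by
  have h1 := (h i).2
  rw [if_neg (not_lt.2 hi), if_pos hi'] at h1
  have hγi := hγ i hi
  have hγk := hγ k (h₁₂.trans hk)
  have h2 := div_le_iSup_iSup (γ := γ) (⟨i, hi, hi'⟩ : I₁ N₁ N₂ N) (⟨k, hk⟩ : I₂ N₂ N)
  have h3 : lam i < 1 / (1 + γ i / γ k) := by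
    refine h1.trans_le ?_
    unfold boundB
    exact one_div_le_one_div_of_le (by positivity) (by simpa using h2)
  rw [lt_div_iff₀ (by positivity)] at h3
  have h4 := mul_lt_mul_of_pos_right h3 hγk
  have h5 : lam i * (1 + γ i / γ k) * γ k = lam i * (γ k + γ i) := by field_simp
  linarith

theorem mul_lt_of_mem_paramBox' (h₁₂ : N₁ ≤ N₂) (hγ : ∀ i : Fin N, N₁ ≤ (i : ℕ) → 0 < γ i)
    (h : lam ∈ paramBox N₁ N₂ γ) {i : Fin N} (hi : N₂ ≤ (i : ℕ)) {k : Fin N}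
    (hk : N₂ ≤ (k : ℕ)) : lam i * γ i < γ k := by
  have h1 := (h i).2
  rw [if_neg (by omega), if_neg (not_lt.2 hi)] at h1
  rw [← lt_div_iff₀ (hγ i (h₁₂.trans hi))]
  exact h1.trans_le (boundD_le (⟨i, hi⟩ : I₂ N₂ N) ⟨k, hk⟩)

theorem mem_unitCube_of_mem_paramBox (h₁₂ : N₁ ≤ N₂) (hγ : ∀ i : Fin N, N₁ ≤ (i : ℕ) → 0 < γ i)
    (h : lam ∈ paramBox N₁ N₂ γ) : (fun i => lam i) ∈ unitCube N := by
  refine fun i => ⟨(h i).1, ?_⟩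
  by_cases hi : N₂ ≤ (i : ℕ)
  · have h1 := mul_lt_of_mem_paramBox' h₁₂ hγ h hi hi
    have := hγ i (h₁₂.trans hi)
    dsimp only
    nlinarith
  · have h1 := (h i).2
    split_ifs at h1 with h2 h3
    · exact h1
    · exact h1.trans_le (boundB_le_one h₁₂ hγ)
    · omega

theorem exists_admissible_of_mem_paramBox (h₁₂ : N₁ ≤ N₂)
    (hγ : ∀ i : Fin N, N₁ ≤ (i : ℕ) → 0 < γ i) (h : lam ∈ paramBox N₁ N₂ γ) :
    ∃ θ < 1, Admissible N₁ N₂ γ (fun i => lam i) θ :=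
  exists_admissible (fun i => (h i).1) (fun i => (mem_unitCube_of_mem_paramBox h₁₂ hγ h i).2)
    (fun _ hi hi' _ hk => mul_lt_of_mem_paramBox h₁₂ hγ h hi hi' hk)
    (fun _ hi _ hk => mul_lt_of_mem_paramBox' h₁₂ hγ h hi hk)

end paramBox

/-- The coordinates of `x`, the `k`-th one being replaced by an indeterminate. -/
def line {N : ℕ} (k : Fin N) (x : Fin N → ℝ) (i : Fin N) : ℝ[X] := if i = k then X else C (x i)

/-- The value of a word as a polynomial in the `k`-th contraction ratio. -/
def wordPoly {N : ℕ} (N₁ N₂ : ℕ) (γ : Fin N → ℝ) (k : Fin N) (w : List (Fin N))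
    (x : Fin N → ℝ) : ℝ[X] :=
  wordEval N₁ N₂ (fun i => C (γ i)) (line k x) w 0

section wordPoly

variable {N N₁ N₂ : ℕ} {γ x : Fin N → ℝ} {k : Fin N}

theorem eval_wordPoly (t : ℝ) (w : List (Fin N)) : (wordPoly N₁ N₂ γ k w x).eval t =
    wordEval N₁ N₂ γ (Function.update x k t) w 0 := by
  rw [← coe_evalRingHom, wordPoly, map_wordEval]
  congr 1
  · funext i; simp
  · funext i
    by_cases hi : i = k
    · subst hi; simp [line]
    · simp [line, hi]
  · simp

theorem taylor_line (i : Fin N) : taylor (x k) (line k x i) = shift k x i := by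
  unfold line shift
  split_ifs with hi
  · subst hi; simp
  · simp

theorem taylor_wordEval_line (w : List (Fin N)) :
    taylor (x k) (wordPoly N₁ N₂ γ k w x) = wordTaylor N₁ N₂ γ k 0 w x := by
  have := map_wordEval (N₁ := N₁) (N₂ := N₂) (fun i => C (γ i)) (line k x)
    (taylorAlgHom (x k) : ℝ[X] →ₐ[ℝ] ℝ[X]).toRingHom w 0
  have e : ∀ p : ℝ[X], (taylorAlgHom (x k) : ℝ[X] →ₐ[ℝ] ℝ[X]).toRingHom p = taylor (x k) p :=
    fun p => rfl
  simp only [e, taylor_C, taylor_line, map_zero] at this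
  rw [wordPoly, this, wordTaylor, C_0]

theorem coeff_wordPoly_cons_self_zero (w : List (Fin N)) :
    (wordPoly N₁ N₂ γ k (k :: w) x).coeff 0 = 0 := by
  rw [wordPoly, wordEval_cons]
  unfold letterMap
  split_ifs <;> simp [line]

/-- Letters other than `k` contract all coefficients, while `k` shifts them by one degree. A
translation is thus added to a constant term that is either freshly zero or just contracted, and
bounds do not accumulate. -/
theorem exists_abs_coeff_wordPoly_le (hx : x ∈ unitCube N) :
    ∃ B, ∀ (w : List (Fin N)) (l : ℕ), |(wordPoly N₁ N₂ γ k w x).coeff l| ≤ B := by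
  obtain ⟨Γ, hΓ⟩ : ∃ Γ, ∀ i, |γ i| ≤ Γ := by
    obtain ⟨Γ, hΓ⟩ := (Set.finite_range fun i => |γ i|).bddAbove
    exact ⟨Γ, fun i => hΓ ⟨i, rfl⟩⟩
  have hΓ0 : 0 ≤ Γ := (abs_nonneg _).trans (hΓ k)
  obtain ⟨ρ, hρ1, hρ⟩ : ∃ ρ < 1, ∀ i, x i ≤ ρ := by
    have : ∀ᶠ θ : ℝ in 𝓝[<] 1, ∀ i, x i ≤ θ :=
      eventually_all.2 fun i => by simpa using eventually_lt_mul (hx i).2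
    obtain ⟨ρ, h1, h2⟩ := (this.and self_mem_nhdsWithin).exists
    exact ⟨ρ, h2, h1⟩
  have hρ0 : 0 ≤ ρ := (hx k).1.le.trans (hρ k)
  -- `D` is the fixed point of `z ↦ ρ * z + Γ`. The invariant allows `D` for the constant term and
  -- `D + Γ` for the others.
  set D := Γ / (1 - ρ) with hD
  have hD' : ρ * D + Γ = D := by
    have : 1 - ρ ≠ 0 := by linarith
    rw [hD]; field_simp; ring
  have hDρ : ρ * (D + Γ) ≤ D := by nlinarith
  have hD0 : 0 ≤ D := div_nonneg hΓ0 (by linarith)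
  refine ⟨D + Γ, fun w => ?_⟩
  suffices H : |(wordPoly N₁ N₂ γ k w x).coeff 0| ≤ D ∧
      ∀ l, |(wordPoly N₁ N₂ γ k w x).coeff l| ≤ D + Γ from H.2
  induction w with
  | nil => exact ⟨by simpa [wordPoly] using hD0, fun l => by simp [wordPoly]; positivity⟩
  | cons i w ih =>
    obtain ⟨ih0, ih⟩ := ih
    obtain ⟨q, g, hq, hq', hg⟩ : ∃ (q : ℝ[X]) (g : ℝ), (∀ l, |q.coeff l| =
        |(wordPoly N₁ N₂ γ k w x).coeff l|) ∧ wordPoly N₁ N₂ γ k (i :: w) x =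
        line k x i * (q + C g) ∧ |g| ≤ Γ := by
      have e : wordPoly N₁ N₂ γ k (i :: w) x =
        letterMap N₁ N₂ (fun i => C (γ i)) (line k x) i (wordPoly N₁ N₂ γ k w x) := rfl
      rw [e]
      unfold letterMap
      split_ifs
      · exact ⟨wordPoly N₁ N₂ γ k w x, 0, fun _ => rfl, by simp, by simpa using hΓ0⟩
      · exact ⟨wordPoly N₁ N₂ γ k w x, γ i, fun _ => rfl, rfl, hΓ i⟩
      · exact ⟨-wordPoly N₁ N₂ γ k w x, γ i, fun _ => by simp, rfl, hΓ i⟩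
    have hr0 : |(q + C g).coeff 0| ≤ D + Γ := by
      rw [coeff_add, coeff_C_zero]
      refine (abs_add_le _ _).trans (add_le_add ?_ hg)
      rw [hq]; exact ih0
    have hr : ∀ l, |(q + C g).coeff (l + 1)| ≤ D + Γ := fun l => by
      rw [coeff_add, coeff_C_succ, add_zero, hq]; exact ih _
    have hrl : ∀ l, |(q + C g).coeff l| ≤ D + Γ := fun l => by
      rcases l with _ | l
      · exact hr0
      · exact hr l
    rw [hq']
    unfold line
    split_ifs with hi
    · refine ⟨by simpa using hD0, fun l => ?_⟩
      rcases l with _ | l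
      · rw [coeff_X_mul_zero, abs_zero]; positivity
      · rw [coeff_X_mul]; exact hrl l
    · have hmul : ∀ l, |(C (x i) * (q + C g)).coeff l| ≤ D := fun l => by
        rw [coeff_C_mul, abs_mul, abs_of_pos (hx i).1]
        exact (mul_le_mul (hρ i) (hrl l) (abs_nonneg _) hρ0).trans hDρ
      exact ⟨hmul 0, fun l => (hmul l).trans (by linarith)⟩

/-- Division by `X + x k` is solved recursively, each coefficient costing one more division by `x
k`. To a fixed order the loss per letter is a constant, hence exponential in word length. -/
theorem abs_coeff_le_of_shift_mul {δ ε : ℝ} (hδ : 0 < δ) (hx : x ∈ unitCube N)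
    (hδx : ∀ i, δ ≤ x i) (i : Fin N) (q : ℝ[X]) (j : ℕ)
    (h : ∀ l ≤ j, |(shift k x i * q).coeff l| ≤ ε) :
    ∀ l ≤ j, |q.coeff l| ≤ ε * (2 / δ) ^ (l + 1) := by
  have hε : 0 ≤ ε := (abs_nonneg _).trans (h 0 (Nat.zero_le _))
  have h1 : 1 ≤ 2 / δ := by
    rw [one_le_div hδ]; linarith [hδx i, (hx i).2]
  have hxi := (hx i).1
  have hbase : ∀ l, |x i * q.coeff l| ≤ ε * (2 * (2 / δ) ^ l) →
      |q.coeff l| ≤ ε * (2 / δ) ^ (l + 1) := fun l hl => by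
    rw [abs_mul, abs_of_pos hxi] at hl
    have h2 := (mul_le_mul_of_nonneg_right (hδx i) (abs_nonneg (q.coeff l))).trans hl
    rw [mul_comm, ← le_div_iff₀ hδ] at h2
    refine h2.trans (le_of_eq ?_)
    rw [pow_succ]; ring
  have hpow : ∀ l, 1 ≤ (2 / δ) ^ l := fun l => one_le_pow₀ h1
  intro l
  induction l with
  | zero =>
    intro hl
    refine hbase 0 ?_
    have h2 := h 0 hl
    unfold shift at h2
    have h3 : |x i * q.coeff 0| ≤ ε := by
      split_ifs at h2 with hi
      · simpa [add_mul] using h2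
      · simpa using h2
    rw [pow_zero, mul_one]; linarith
  | succ l ih =>
    intro hl
    refine hbase _ ?_
    have h2 := h (l + 1) hl
    have h4 := ih (by omega)
    have h5 := mul_le_mul_of_nonneg_left (hpow (l + 1)) hε
    unfold shift at h2
    split_ifs at h2 with hi
    · rw [add_mul, coeff_add, coeff_X_mul, coeff_C_mul] at h2
      have h6 := abs_sub (q.coeff l + x i * q.coeff (l + 1)) (q.coeff l)
      rw [add_sub_cancel_left] at h6
      linarith
    · rw [coeff_C_mul] at h2
      linarith [abs_nonneg (x i * q.coeff (l + 1))]

theorem abs_coeff_le_of_prod_shift_mul {δ ε : ℝ} (hδ : 0 < δ) (hx : x ∈ unitCube N)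
    (hδx : ∀ i, δ ≤ x i) (w : List (Fin N)) (q : ℝ[X]) (j : ℕ)
    (h : ∀ l ≤ j, |((w.map (shift k x)).prod * q).coeff l| ≤ ε) :
    ∀ l ≤ j, |q.coeff l| ≤ ε * ((2 / δ) ^ (j + 1)) ^ w.length := by
  induction w generalizing ε with
  | nil => simpa using h
  | cons i w ih =>
    have hε : 0 ≤ ε := (abs_nonneg _).trans (h 0 (Nat.zero_le _))
    have h1 : 1 ≤ 2 / δ := by
      rw [one_le_div hδ]; linarith [hδx i, (hx i).2]
    rw [List.map_cons, List.prod_cons, mul_assoc] at h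
    have h2 := abs_coeff_le_of_shift_mul hδ hx hδx i _ j h
    have h3 := ih (ε := ε * (2 / δ) ^ (j + 1)) fun l hl => (h2 l hl).trans
      (mul_le_mul_of_nonneg_left (pow_le_pow_right₀ h1 (by omega)) hε)
    intro l hl
    refine (h3 l hl).trans (le_of_eq ?_)
    rw [List.length_cons, pow_succ]; ring

theorem map_shift_of_notMem {b : List (Fin N)} (hb : k ∉ b) :
    (b.map (shift k x)).prod = C (b.map x).prod := by
  induction b with
  | nil => simp
  | cons i b ih =>
    rw [List.mem_cons, not_or] at hb
    simp [ih hb.2, shift, Ne.symm hb.1]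

end wordPoly

/-- At a fixed parameter, the Taylor coefficients in the direction `k` of the differences which
split at `k` are not all superexponentially small. -/
theorem exists_taylor_coeff_large {N N₁ N₂ : ℕ} (h₁₂ : N₁ ≤ N₂) {γ x : Fin N → ℝ}
    (hγ : ∀ i : Fin N, N₁ ≤ (i : ℕ) → 0 < γ i) (hx : x ∈ unitCube N) {θ : ℝ} (hθ : θ < 1)
    (hadm : Admissible N₁ N₂ γ x θ) (k : Fin N) :
    ∃ j b n₀ : ℕ, ∀ n, n₀ ≤ n → ∀ w v : List (Fin N), w.length = n → SplitsAt N₁ N₂ k w v →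
      ∃ i ≤ j, (1 / 2 : ℝ) ^ (b * n) <
        |(wordTaylor N₁ N₂ γ k 0 w x - wordTaylor N₁ N₂ γ k 0 v x).coeff i| := by
  by_contra! H
  obtain ⟨B, hB⟩ := exists_abs_coeff_wordPoly_le (N₁ := N₁) (N₂ := N₂) (γ := γ) (k := k) hx
  obtain ⟨δ, hδ, hδx⟩ : ∃ δ > 0, ∀ i, δ ≤ x i := by
    have : ∀ᶠ δ : ℝ in 𝓝[>] 0, ∀ i, δ ≤ x i :=
      eventually_all.2 fun i => (eventually_nhdsWithin_of_eventually_nhds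
        (gt_mem_nhds (hx i).1)).mono fun _ h => h.le
    obtain ⟨δ, h1, h2⟩ := (this.and self_mem_nhdsWithin).exists
    exact ⟨δ, h2, h1⟩
  obtain ⟨c, hc, hcs⟩ : ∃ c > 0, ∀ s : Fin N, N₁ ≤ (s : ℕ) → c ≤ x s * γ s * (1 - θ) := by
    have : ∀ᶠ c : ℝ in 𝓝[>] 0, ∀ s : Fin N, N₁ ≤ (s : ℕ) → c ≤ x s * γ s * (1 - θ) := by
      simp only [eventually_all]
      intro s hs
      have h1 : 0 < x s * γ s * (1 - θ) :=
        mul_pos (mul_pos (hx s).1 (hγ s hs)) (by linarith)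
      exact (eventually_nhdsWithin_of_eventually_nhds (gt_mem_nhds h1)).mono fun _ h => h.le
    obtain ⟨c, h1, h2⟩ := (this.and self_mem_nhdsWithin).exists
    exact ⟨c, h2, h1⟩
  have h1δ : 1 ≤ 2 / δ := by
    rw [one_le_div hδ]; linarith [hδx k, (hx k).2]
  refine not_forall_small_taylor_coeff (t := x k) (C := B) (c := c) (hx k).1 (hx k).2 hc fun j => ?_
  set K := (2 / δ) ^ (j + 1) with hK
  have hK1 : 1 ≤ K := one_le_pow₀ h1δ
  -- The factor `K ^ 2` absorbs the division by up to `2 * n` letters, and the 2 leaves a decay of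
  -- `2^(-n)`.
  obtain ⟨b, hb⟩ := pow_unbounded_of_one_lt (2 * K ^ 2) (show (1 : ℝ) < 2 by norm_num)
  -- The last `j` serves as threshold: `n ≥ j` turns `2^(-n)` into at most `1 / (j + 1)`.
  obtain ⟨n, hn, w, v, hw, ⟨pre, a, β, u, u', s, s', e, hpre, hβ, hs, hs', hsk, hkβ, hka, hfac⟩,
    hsmall⟩ := H j b j
  have hβpos : 0 < (β.map x).prod := List.prod_pos fun y hy => by
    obtain ⟨i, _, rfl⟩ := List.mem_map.1 hy
    exact (hx i).1
  have hapos : 0 < ((a.filter (· ≠ k)).map x).prod := List.prod_pos fun y hy => by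
    obtain ⟨i, _, rfl⟩ := List.mem_map.1 hy
    exact (hx i).1
  -- Only the occurrences of `k` in `a` depend on the variable; the remaining letters, divided by
  -- `β`, form a positive constant.
  set κ := ((a.filter (· ≠ k)).map x).prod / (β.map x).prod with hκ
  set A := wordPoly N₁ N₂ γ k (s :: u) x with hA
  set Q := wordPoly N₁ N₂ γ k (s' :: u') x with hQ
  have hupd : Function.update x k (x k) = x := Function.update_eq_self k x
  refine ⟨A, Q, κ, a.count k, by positivity, hB _, hB _, ?_, ?_, ?_, ?_, ?_⟩
  · rw [coeff_zero_eq_eval_zero, hA, eval_wordPoly]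
    refine (hcs s hs).trans ?_
    have := (hadm.update_zero h₁₂ hγ k).le_wordEval_cons h₁₂ hγ hs u
    rwa [Function.update_of_ne hsk] at this
  · rw [hA, eval_wordPoly, hupd]
    exact (hcs s hs).trans (hadm.le_wordEval_cons h₁₂ hγ hs u)
  · rw [hQ, eval_wordPoly, hupd]
    exact (hcs s' hs').trans (hadm.le_wordEval_cons h₁₂ hγ hs' u')
  · rcases hka with h | h
    · exact Or.inl (List.count_pos_iff.2 h).ne'
    · right; subst h; exact coeff_wordPoly_cons_self_zero u'
  · set g := A - C κ * X ^ a.count k * Q with hg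
    have hkey : wordTaylor N₁ N₂ γ k 0 w x - wordTaylor N₁ N₂ γ k 0 v x =
        (-1) ^ e * (((pre ++ β).map (shift k x)).prod * taylor (x k) g) := by
      have h1 := hfac ℝ[X] (fun i => C (γ i)) (shift k x)
      have h2 : ∀ w : List (Fin N), wordEval N₁ N₂ (fun i => C (γ i)) (shift k x) w 0 =
          taylor (x k) (wordPoly N₁ N₂ γ k w x) := fun w => by
        rw [taylor_wordEval_line, wordTaylor, C_0]
      have h3 : wordTaylor N₁ N₂ γ k 0 w x - wordTaylor N₁ N₂ γ k 0 v x =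
          wordEval N₁ N₂ (fun i => C (γ i)) (shift k x) w 0 -
          wordEval N₁ N₂ (fun i => C (γ i)) (shift k x) v 0 := by
        rw [wordTaylor, wordTaylor, C_0]
      have hkf : k ∉ a.filter (· ≠ k) := by simp [List.mem_filter]
      rw [h3, h1, h2, h2, ← hA, ← hQ, prod_map_eq_pow_count_mul (shift k x) k a,
        map_shift_of_notMem hkf, hg, List.map_append, List.prod_append, map_shift_of_notMem hkβ, map_sub, taylor_mul, taylor_mul, taylor_C,
        taylor_pow, taylor_X]
      have h4 : C ((a.filter (· ≠ k)).map x).prod = C (β.map x).prod * C κ := by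
        rw [← C_mul, hκ, mul_div_cancel₀ _ hβpos.ne']
      have h5 : shift k x k = X + C (x k) := by simp [shift]
      rw [h4, h5]
      ring
    have habs : ∀ l ≤ j, |(((pre ++ β).map (shift k x)).prod * taylor (x k) g).coeff l| ≤
        (1 / 2 : ℝ) ^ (b * n) := fun l hl => by
      have := hsmall l hl
      rw [hkey] at this
      rcases neg_one_pow_eq_or ℝ[X] e with he | he <;> rw [he] at this
      · simpa using this
      · simpa using this
    intro i hi
    refine (abs_coeff_le_of_prod_shift_mul hδ hx hδx _ _ j habs i hi).trans ?_
    have hlen : (pre ++ β).length ≤ 2 * n := by rw [List.length_append]; omega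
    calc (1 / 2 : ℝ) ^ (b * n) * K ^ (pre ++ β).length
        ≤ (1 / 2 : ℝ) ^ (b * n) * K ^ (2 * n) := by gcongr
      _ = (K ^ 2 / 2 ^ b) ^ n := by
          rw [pow_mul, pow_mul, ← mul_pow, one_div, inv_pow]; congr 1; ring
      _ ≤ (1 / 2) ^ n := by
          refine pow_le_pow_left₀ (by positivity) ?_ n
          rw [div_le_div_iff₀ (by positivity) (by norm_num)]
          linarith
      _ ≤ 1 / ((n : ℝ) + 1) := by
          rw [one_div_pow]
          refine one_div_le_one_div_of_le (by positivity) ?_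
          exact_mod_cast n.lt_two_pow_self
      _ ≤ 1 / ((j : ℝ) + 1) := by
          refine one_div_le_one_div_of_le (by positivity) ?_
          have : (j : ℝ) ≤ n := by exact_mod_cast hn
          linarith

end CFS
end

/-! ### The exceptional set and its dimension. -/

noncomputable section

namespace CFS

open Polynomial

/-- The set of points of the unit cube at which, for infinitely many `n`, a polynomial of the `n`-th
family has a superexponentially small `j`-th coefficient but not so small a next coefficient. -/
def smallCoeffSet {α : Type*} {N : ℕ} (G : ℕ → Finset α) (P : α → (Fin N → ℝ) → ℝ[X])
    (j b₁ : ℕ) : Set (Fin N → ℝ) :=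
  {x | x ∈ unitCube N ∧ ∀ b m : ℕ, ∃ n, m ≤ n ∧ ∃ g ∈ G n,
    |(P g x).coeff j| ≤ (1 / 2) ^ (b * n) ∧
      (1 / 2) ^ (b₁ * n) ≤ |((j : ℝ) + 1) * (P g x).coeff (j + 1)|}

/-- The derivative of the `j`-th Taylor coefficient in direction `k` is `j + 1` times the next one,
so `dimH_small_value_le` applies to this pair. -/
theorem dimH_smallCoeffSet_le {α : Type*} {d : ℕ} (k : α → Fin (d + 1)) (G : ℕ → Finset α)
    (P : α → (Fin (d + 1) → ℝ) → ℝ[X]) (j b₁ : ℕ) {μ : ℕ} {B : ℝ}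
    (hcard : ∀ n, 1 ≤ n → (G n).card ≤ 2 ^ (μ * n))
    (hP : ∀ n, 1 ≤ n → ∀ g ∈ G n, TaylorBound (k g) (B * 8 ^ n) (P g)) :
    dimH (smallCoeffSet G P j b₁) ≤ d := by
  obtain ⟨c, hc⟩ := pow_unbounded_of_one_lt B (show (1 : ℝ) < 2 by norm_num)
  have hP' : ∀ n, 1 ≤ n → ∀ g ∈ G n, TaylorBound (k g) (2 ^ ((c + 3) * n)) (P g) :=
    fun n hn g hg => (hP n hn g hg).mono (by
      rw [add_mul, pow_add]
      refine mul_le_mul (hc.le.trans ?_) (le_of_eq ?_) (by positivity) (by positivity)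
      · exact pow_le_pow_right₀ (by norm_num) (Nat.le_mul_of_pos_right c hn)
      · rw [pow_mul]; norm_num)
  exact dimH_small_value_le k G (fun g x => (P g x).coeff j)
    (fun g x => ((j : ℝ) + 1) * (P g x).coeff (j + 1)) μ (c + 3) b₁ (by omega) hcard
    (fun n hn g hg => (hP' n hn g hg).lipschitz j) (fun n hn g hg => (hP' n hn g hg).taylor j)

/-- Euler's identity for a monomial. It shows that words of equal ratio with different counts of `k`
have different derivatives in direction `k`. -/
theorem mul_coeff_one_wordTaylor {N : ℕ} (γ : Fin N → ℝ) (k : Fin N) (w : List (Fin N))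
    (x : Fin N → ℝ) : x k * (wordTaylor N N γ k 1 w x).coeff 1 = w.count k * wordRatio x w := by
  induction w with
  | nil =>
    have e : wordTaylor N N γ k 1 [] x = C 1 := rfl
    rw [e, coeff_C_of_ne_zero one_ne_zero]; simp
  | cons i w ih =>
    have e : wordTaylor N N γ k 1 (i :: w) x = shift k x i * wordTaylor N N γ k 1 w x := by
      rw [wordTaylor, wordEval_cons, letterMap, if_pos i.2]; rfl
    have er : wordRatio x (i :: w) = x i * wordRatio x w := by simp [wordRatio]
    rw [e, er]
    unfold shift
    split_ifs with hi
    · subst hi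
      rw [add_mul, coeff_add, coeff_X_mul, coeff_C_mul, coeff_zero_wordTaylor,
        ← wordRatio_eq_wordEval, List.count_cons_self, mul_add, ih]
      push_cast; ring
    · rw [coeff_C_mul, List.count_cons_of_ne hi]
      linear_combination x i * ih

/-- The parameters at which two words with different numbers of occurrences of some symbol have the
same contraction ratio. -/
theorem dimH_wordRatio_eq_le {d : ℕ} (w v : List (Fin (d + 1))) (hwv : ¬ w.Perm v) :
    dimH {x : Fin (d + 1) → ℝ | x ∈ unitCube (d + 1) ∧ wordRatio x w = wordRatio x v} ≤ d := by
  obtain ⟨k, hk⟩ : ∃ k, w.count k ≠ v.count k := by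
    by_contra! h
    exact hwv (List.perm_iff_count.2 h)
  set P : Unit → (Fin (d + 1) → ℝ) → ℝ[X] := fun _ x =>
    wordTaylor (d + 1) (d + 1) 0 k 1 w x - wordTaylor (d + 1) (d + 1) 0 k 1 v x with hP
  have hsub : {x : Fin (d + 1) → ℝ | x ∈ unitCube (d + 1) ∧ wordRatio x w = wordRatio x v} ⊆
      ⋃ b₁ : ℕ, smallCoeffSet (fun _ => {()}) P 0 b₁ := by
    rintro x ⟨hx, hxwv⟩
    have hxk := (hx k).1
    have hpos : 0 < wordRatio x v := List.prod_pos fun y hy => by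
      obtain ⟨i, _, rfl⟩ := List.mem_map.1 hy
      exact (hx i).1
    have h0 : (P () x).coeff 0 = 0 := by
      rw [hP, coeff_sub, coeff_zero_wordTaylor, coeff_zero_wordTaylor, ← wordRatio_eq_wordEval,
        ← wordRatio_eq_wordEval, hxwv, sub_self]
    have h1 : (P () x).coeff 1 ≠ 0 := by
      intro h
      rw [hP, coeff_sub] at h
      have h2 : x k * (wordTaylor (d + 1) (d + 1) 0 k 1 w x).coeff 1 -
          x k * (wordTaylor (d + 1) (d + 1) 0 k 1 v x).coeff 1 = 0 := by
        rw [← mul_sub, h, mul_zero]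
      rw [mul_coeff_one_wordTaylor, mul_coeff_one_wordTaylor, hxwv, ← sub_mul, mul_eq_zero,
        sub_eq_zero] at h2
      exact hk (by exact_mod_cast h2.resolve_right hpos.ne')
    obtain ⟨b₁, hb₁⟩ := exists_pow_lt_of_lt_one (abs_pos.2 h1) (show (1 / 2 : ℝ) < 1 by norm_num)
    -- The family does not depend on `n`; `m + 1` only ensures `n ≥ 1`, so that `b₁ * n ≥ b₁`.
    refine Set.mem_iUnion.2 ⟨b₁, hx, fun b m => ⟨m + 1, by omega, (), by simp, ?_, ?_⟩⟩
    · rw [h0, abs_zero]; positivity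
    · simp only [Nat.cast_zero, zero_add, one_mul]
      exact (pow_le_pow_of_le_one (by norm_num) (by norm_num)
        (Nat.le_mul_of_pos_right b₁ (by omega))).trans hb₁.le
  refine (dimH_mono hsub).trans ?_
  rw [dimH_iUnion]
  refine iSup_le fun b₁ => dimH_smallCoeffSet_le (fun _ => k) _ P 0 b₁ (μ := 0)
    (B := 8 ^ w.length + 8 ^ v.length) (by simp) fun n hn _ _ => ?_
  have hw : ∀ w, TaylorBound k (1 * 8 ^ w.length) (wordTaylor (d + 1) (d + 1) 0 k 1 w) :=
    taylorBound_wordTaylor _ _ _ k (by simp) (by simp)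
  refine ((hw w).sub (hw v)).mono ?_
  rw [one_mul, one_mul]
  exact le_mul_of_one_le_right (by positivity) (one_le_pow₀ (by norm_num))

/-- The words of length `n`. -/
def words (N n : ℕ) : Finset (List (Fin N)) :=
  (Finset.univ : Finset (Fin n → Fin N)).image List.ofFn

theorem mem_words {N n : ℕ} {w : List (Fin N)} : w ∈ words N n ↔ w.length = n := by
  simp only [words, Finset.mem_image, Finset.mem_univ, true_and]
  constructor
  · rintro ⟨f, rfl⟩; simp
  · rintro rfl; exact ⟨w.get, List.ofFn_get w⟩

theorem card_words_le (N n : ℕ) : (words N n).card ≤ N ^ n := by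
  refine Finset.card_image_le.trans ?_
  simp

/-- All pairs of words of length `n`, together with a direction. -/
def wordPairs (N n : ℕ) : Finset (Fin N × List (Fin N) × List (Fin N)) :=
  Finset.univ ×ˢ words N n ×ˢ words N n

theorem card_wordPairs_le (N n : ℕ) (hn : 1 ≤ n) : (wordPairs N n).card ≤ 2 ^ (3 * N * n) := by
  have h1 := card_words_le N n
  have h2 : N ≤ 2 ^ N := N.lt_two_pow_self.le
  rw [wordPairs, Finset.card_product, Finset.card_product, Finset.card_univ, Fintype.card_fin]
  calc N * ((words N n).card * (words N n).card) ≤ N * (N ^ n * N ^ n) := by gcongr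
    _ ≤ 2 ^ N * ((2 ^ N) ^ n * (2 ^ N) ^ n) := by gcongr
    _ = 2 ^ (N + (N * n + N * n)) := by rw [← pow_mul, ← pow_add, ← pow_add]
    _ ≤ 2 ^ (3 * N * n) := by
        refine Nat.pow_le_pow_right (by norm_num) ?_
        have : N ≤ N * n := Nat.le_mul_of_pos_right N hn
        have e : 3 * N * n = 3 * (N * n) := by ring
        omega

/-- The difference of the Taylor expansions of the values of two words. -/
def pairTaylor {N : ℕ} (N₁ N₂ : ℕ) (γ : Fin N → ℝ) (g : Fin N × List (Fin N) × List (Fin N))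
    (x : Fin N → ℝ) : ℝ[X] :=
  wordTaylor N₁ N₂ γ g.1 0 g.2.1 x - wordTaylor N₁ N₂ γ g.1 0 g.2.2 x

theorem dimH_smallCoeffSet_pairTaylor_le {d : ℕ} (N₁ N₂ : ℕ) (γ : Fin (d + 1) → ℝ) (j b₁ : ℕ) :
    dimH (smallCoeffSet (wordPairs (d + 1)) (pairTaylor N₁ N₂ γ) j b₁) ≤ d := by
  obtain ⟨Γ, hΓ⟩ := (Set.finite_range fun i => |γ i|).bddAbove
  have hΓ' : ∀ i, |γ i| ≤ Γ := fun i => hΓ ⟨i, rfl⟩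
  have hΓ0 : |(0 : ℝ)| ≤ Γ := by
    rw [abs_zero]; exact (abs_nonneg _).trans (hΓ' 0)
  refine dimH_smallCoeffSet_le (fun g => g.1) _ _ j b₁ (card_wordPairs_le (d + 1)) (B := 2 * Γ)
    fun n hn g hg => ?_
  simp only [wordPairs, Finset.mem_product, mem_words] at hg
  have h1 := taylorBound_wordTaylor N₁ N₂ γ g.1 hΓ0 hΓ' g.2.1
  have h2 := taylorBound_wordTaylor N₁ N₂ γ g.1 hΓ0 hΓ' g.2.2
  rw [hg.2.1] at h1
  rw [hg.2.2] at h2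
  exact (h1.sub h2).mono (le_of_eq (by ring))

/-- The parameters at which the exponential separation condition fails are covered by countably many
sets of small dimension. -/
theorem exists_mem_smallCoeffSet_of_not_ESC {N N₁ N₂ : ℕ} (h₁₂ : N₁ ≤ N₂)
    {γ x : Fin N → ℝ} (hγ : ∀ i : Fin N, N₁ ≤ (i : ℕ) → 0 < γ i) (hx : x ∈ unitCube N) {θ : ℝ}
    (hθ : θ < 1) (hadm : Admissible N₁ N₂ γ x θ)
    (hratio : ∀ w v : List (Fin N), wordRatio x w = wordRatio x v → w.Perm v)
    (hESC : ¬ ESC N₁ N₂ γ x) :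
    ∃ j b₁, x ∈ smallCoeffSet (wordPairs N) (pairTaylor N₁ N₂ γ) j b₁ := by
  -- Smallness is required in all directions, which is free at order 0, where the coefficient does
  -- not depend on `k`. Failure of `S` then supplies one direction with a large coefficient.
  set S : ℕ → Prop := fun J => ∀ b m : ℕ, ∃ n, m ≤ n ∧ ∃ w v : List (Fin N), w.length = n ∧
    v.length = n ∧ (∃ k, SplitsAt N₁ N₂ k w v) ∧
    ∀ k, ∀ i ≤ J, |(pairTaylor N₁ N₂ γ (k, w, v) x).coeff i| ≤ (1 / 2) ^ (b * n) with hS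
  have hS0 : S 0 := by
    intro b m
    unfold ESC at hESC
    push Not at hESC
    obtain ⟨n, hn, w, v, hw, hv, hwv, hsame, hproj⟩ := hESC m (b + 2) (by
      have : (0 : ℝ) ≤ b := by positivity
      linarith)
    refine ⟨n, hn, w, v, hw, hv,
      (sameBlockStructure_or_splitsAt n w v hw.le (hratio w v hwv)).resolve_left hsame,
      fun k i hi => ?_⟩
    obtain rfl : i = 0 := by omega
    simp only [pairTaylor]
    rw [coeff_sub, coeff_zero_wordTaylor, coeff_zero_wordTaylor, ← proj_eq_wordEval,
      ← proj_eq_wordEval]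
    refine hproj.trans ?_
    rw [one_div, inv_pow, ← Real.rpow_natCast 2, ← Real.rpow_neg (by norm_num)]
    refine Real.rpow_le_rpow_of_exponent_le (by norm_num) ?_
    push_cast
    have : (0 : ℝ) ≤ n := by positivity
    nlinarith
  have hSJ : ∃ J, ¬ S J := by
    -- The constants depend on the direction; there are finitely many, so suprema work for all.
    choose j b n₀ hlarge using exists_taylor_coeff_large h₁₂ hγ hx hθ hadm
    refine ⟨Finset.univ.sup j, fun H => ?_⟩
    obtain ⟨n, hn, w, v, hw, -, ⟨k, hk⟩, hsmall⟩ := H (Finset.univ.sup b) (Finset.univ.sup n₀)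
    obtain ⟨i, hi, h1⟩ := hlarge k n ((Finset.le_sup (Finset.mem_univ k)).trans hn) w v hw hk
    have h2 := hsmall k i (hi.trans (Finset.le_sup (Finset.mem_univ k)))
    refine absurd h1 (not_lt.2 (h2.trans ?_))
    exact pow_le_pow_of_le_one (by norm_num) (by norm_num)
      (Nat.mul_le_mul_right n (Finset.le_sup (Finset.mem_univ k)))
  obtain ⟨j, hj, hj'⟩ : ∃ j, S j ∧ ¬ S (j + 1) := by
    by_contra! H
    obtain ⟨J, hJ⟩ := hSJ
    exact hJ (Nat.rec hS0 H J)
  rw [hS] at hj'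
  push Not at hj'
  obtain ⟨b₁, m₁, hlarge⟩ := hj'
  refine ⟨j, b₁, hx, fun b m => ?_⟩
  -- A rate of at least `b₁` keeps the coefficients up to order `j` below the threshold, so the
  -- large one has order exactly `j + 1`.
  obtain ⟨n, hn, w, v, hw, hv, hsplit, hsmall⟩ := hj (max b b₁) (max m m₁)
  obtain ⟨k, i, hi, h1⟩ := hlarge n ((le_max_right _ _).trans hn) w v hw hv hsplit
  have hpow : ∀ c, c ≤ max b b₁ → (1 / 2 : ℝ) ^ (max b b₁ * n) ≤ (1 / 2) ^ (c * n) := fun c hc =>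
    pow_le_pow_of_le_one (by norm_num) (by norm_num) (Nat.mul_le_mul_right n hc)
  have hij : i = j + 1 := by
    by_contra hne
    exact absurd ((hsmall k i (by omega)).trans (hpow b₁ (le_max_right _ _))) (not_le.2 h1)
  subst hij
  refine ⟨n, (le_max_left _ _).trans hn, (k, w, v), ?_,
    (hsmall k j le_rfl).trans (hpow b (le_max_left _ _)), ?_⟩
  · simp [wordPairs, mem_words, hw, hv]
  · rw [abs_mul, abs_of_pos (by positivity)]
    refine h1.le.trans (le_mul_of_one_le_left (abs_nonneg _) ?_)
    have : (0 : ℝ) ≤ j := by positivity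
    linarith

end CFS
end

theorem proposition3p2 (N₁ N₂ N₃ : ℕ) (h₁₂ : N₁ ≤ N₂) (h₂₃ : N₂ ≤ N₃) (h₃ : 1 ≤ N₃)
    (γ : Fin N₃ → ℝ) (hγ : ∀ i : Fin N₃, N₁ ≤ (i : ℕ) → 0 < γ i) :
    ∃ E : Set (EuclideanSpace ℝ (Fin N₃)),
      E ⊆ CFS.paramBox N₁ N₂ γ ∧
      dimH E ≤ ((N₃ - 1 : ℕ) : ENNReal) ∧
      ∀ lam ∈ CFS.paramBox N₁ N₂ γ \ E, CFS.ESC N₁ N₂ γ (fun i => lam i) := by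
  obtain ⟨d, rfl⟩ := Nat.exists_eq_add_of_le' h₃
  refine ⟨{lam | lam ∈ CFS.paramBox N₁ N₂ γ ∧ ¬ CFS.ESC N₁ N₂ γ (fun i => lam i)},
    fun lam h => h.1, ?_, fun lam h => by_contra fun h' => h.2 ⟨h.1, h'⟩⟩
  -- A continuous linear equivalence preserves Hausdorff dimension, so the sup norm may replace the
  -- Euclidean one.
  rw [← (EuclideanSpace.equiv (Fin (d + 1)) ℝ).dimH_image, Nat.add_sub_cancel]
  have hsub : (EuclideanSpace.equiv (Fin (d + 1)) ℝ) ''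
      {lam | lam ∈ CFS.paramBox N₁ N₂ γ ∧ ¬ CFS.ESC N₁ N₂ γ (fun i => lam i)} ⊆
      (⋃ p : {p : List (Fin (d + 1)) × List (Fin (d + 1)) // ¬ p.1.Perm p.2},
        {x | x ∈ CFS.unitCube (d + 1) ∧ CFS.wordRatio x p.1.1 = CFS.wordRatio x p.1.2}) ∪
      ⋃ q : ℕ × ℕ, CFS.smallCoeffSet (CFS.wordPairs (d + 1)) (CFS.pairTaylor N₁ N₂ γ) q.1 q.2 := by
    rintro _ ⟨lam, ⟨hbox, hESC⟩, rfl⟩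
    have hcube := CFS.mem_unitCube_of_mem_paramBox h₁₂ hγ hbox
    obtain ⟨θ, hθ, hadm⟩ := CFS.exists_admissible_of_mem_paramBox h₁₂ hγ hbox
    by_cases hratio : ∀ w v : List (Fin (d + 1)),
        CFS.wordRatio (fun i => lam i) w = CFS.wordRatio (fun i => lam i) v → w.Perm v
    · obtain ⟨j, b₁, h⟩ :=
        CFS.exists_mem_smallCoeffSet_of_not_ESC h₁₂ hγ hcube hθ hadm hratio hESC
      exact Or.inr (Set.mem_iUnion.2 ⟨(j, b₁), h⟩)
    · push Not at hratio
      obtain ⟨w, v, h1, h2⟩ := hratio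
      exact Or.inl (Set.mem_iUnion.2 ⟨⟨(w, v), h2⟩, hcube, h1⟩)
  refine (dimH_mono hsub).trans ?_
  rw [dimH_union, dimH_iUnion, dimH_iUnion]
  exact max_le (iSup_le fun p => CFS.dimH_wordRatio_eq_le _ _ p.2)
    (iSup_le fun q => CFS.dimH_smallCoeffSet_pairTaylor_le N₁ N₂ γ q.1 q.2)
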